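/- **Setting.** Let $A\in\mathbb R^{p\times p}$, $B\in\mathbb R^{p\times q}$, $C_1,C_2\in\mathbb R^{m\times p}$, let $K,L_1,L_2$ be gains such that $A+BK$, $A+L_1C_1$, $A+L_2C_2$ are Schur stable, and for $\alpha\in\{0,1\}$ put $C(\alpha)=\alpha C_1+(1-\alpha)C_2$, $L(\alpha)=\alpha L_1+(1-\alpha)L_2$. Write $C=C_1$, $L=L_1$ and assume that $k'=\min\{k\ge 0: C(A+BK)^kB\neq 0\}$ exists. The process noise $(w_n)$, the measurement noises $(z_n)$, $(\eta_n)$ and the private excitation $(e_n)$ are each bounded, zero mean and i.i.d.; $w$ is independent of $(z,\eta)$, and $\Sigma_E=\mathbb E[e_0e_0^\top]$ is positive definite. With $u_n=Kx_n'+e_n$, the attacked closed loop is $$x_{n+1}=Ax_n+Bu_n+w_n,\qquad \tilde y_n=C(\alpha_n)x_n+\alpha_nz_n+(1-\alpha_n)\eta_n+\alpha_nv_n,$$ $$x'_{n+1}=Ax'_n+Bu_n+L(\alpha_n)\big(C(\alpha_n)x'_n-\tilde y_n\big).$$ A second observer always uses the vulnerable sensor $y_n=Cx_n+z_n+v_n$: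 $$\hat x_{n+1}=A\hat x_n+Bu_n+L(C\hat x_n-y_n),\qquad \hat x_0=x_0.$$ Let $\delta_0=0$, $\delta_{n+1}=(A+LC)\delta_n-w_n-Lz_n$ be its attack-free error and, for $N\ge 1$ (with $e_j=0$ for $j<0$), $$\Phi^{(1)}_N=\frac1N\sum_{n=0}^{N-1}(C\hat x_n-y_n)(C\hat x_n-y_n)^\top-\frac1N\sum_{n=0}^{N-1}\mathbb E\big[(C\delta_n-z_n)(C\delta_n-z_n)^\top\big],\qquad \Phi^{(2)}_N=\frac1N\sum_{n=0}^{N-1}(C\hat x_n-y_n)e_{n-k'-1}^\top .$$ Let $\rho,S>0$, $t_N=\sqrt{(1+\rho)S\log N/N}$, and let $$E_N=\{\|\Phi^{(1)}_N\|>t_N\}\cup\{\|\Phi^{(2)}_N\|>t_N\}$$ (spectral norm) be the event that an attack is reported at time $N$. Let $\tau\ge 1$ be an integer. The switching signal has $\alpha_0=1$ and, for $N\ge 1$: $\alpha_N=0$ if $\|\Phi_N^{(1)}\|\ge t_N$ or $\|\Phi_N^{(2)}\|\ge t_N$; otherwise $\alpha_N=1$ if $N\ge\tau$ and $\alpha_{N-1}=\dots=\alpha_{N-\tau}=0$;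 otherwise $\alpha_N=\alpha_{N-1}$. **Attack.** For some $\gamma\in\mathbb R$, $$v_n=C\xi_n+\zeta_n-\gamma\,(Cx_n+z_n),\qquad \xi_{n+1}=(A+BK)\xi_n+\omega_n,$$ with bounded random sequences $(\omega_n)$, $(\zeta_n)$. The excitation is private: $(e_n)_n$ is independent of the initial conditions $x_0,x'_0,\xi_0$ and the sequences $(w_n,z_n,\eta_n,\omega_n,\zeta_n)_n$ together. The attack is nontrivial, i.e. it is not the case that almost surely $v_n=0$ for all $n$. If $\gamma=0$, assume in addition that the pairs $(\omega_n,\zeta_n)$ are zero mean and i.i.d. over $n$ and independent of $(w_n,z_n,\eta_n)_n$, and that either $\xi_0=0$ almost surely or $v$ does not have zero average power, i.e. it is not the case that $\frac1N\sum_{n=0}^{N-1}v_n^\top v_n\to0$ almost surely. **Theorem.** Then $\mathrm P\big(\limsup_{N\to\infty}\neg E_N\big)=0$; that is, almost surely the test fails to detect the attack only finitely many times. -/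

import Mathlib

open MeasureTheory ProbabilityTheory Filter Topology Matrix
open scoped Matrix.Norms.L2Operator

namespace Watermark

/-- Schur stability: every complex eigenvalue has modulus less than one. -/
def SchurStable {d : ℕ} (M : Matrix (Fin d) (Fin d) ℝ) : Prop :=
  ∀ l ∈ spectrum ℂ (M.map (algebraMap ℝ ℂ)), ‖l‖ < 1

/-- Plant matrices `A`, `B`, the two sensor matrices `C₁` (accurate, vulnerable) and `C₂` (secure),
the feedback gain `K` and the two observer gains. -/
structure Plant (p q m : ℕ) where
  A : Matrix (Fin p) (Fin p) ℝ
  B : Matrix (Fin p) (Fin q) ℝ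
  C₁ : Matrix (Fin m) (Fin p) ℝ
  C₂ : Matrix (Fin m) (Fin p) ℝ
  K : Matrix (Fin q) (Fin p) ℝ
  L₁ : Matrix (Fin p) (Fin m) ℝ
  L₂ : Matrix (Fin p) (Fin m) ℝ

namespace Plant

variable {p q m : ℕ}

/-- The gains are stabilizing. -/
structure Stable (P : Plant p q m) : Prop where
  feedback : SchurStable (P.A + P.B * P.K)
  observer₁ : SchurStable (P.A + P.L₁ * P.C₁)
  observer₂ : SchurStable (P.A + P.L₂ * P.C₂)

/-- `C(α) = α C₁ + (1 - α) C₂`. -/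
def C (P : Plant p q m) (a : ℝ) : Matrix (Fin m) (Fin p) ℝ := a • P.C₁ + (1 - a) • P.C₂

/-- `L(α) = α L₁ + (1 - α) L₂`. -/
def L (P : Plant p q m) (a : ℝ) : Matrix (Fin p) (Fin m) ℝ := a • P.L₁ + (1 - a) • P.L₂

/-- `k' = min {k ≥ 0 | C₁ (A + B K) ^ k B ≠ 0}`. -/
noncomputable def lag (P : Plant p q m) : ℕ :=
  sInf {k : ℕ | P.C₁ * (P.A + P.B * P.K) ^ k * P.B ≠ 0}

end Plant

/-- A process that is bounded, uniformly in time, almost surely. Boundedness does not depend on the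
norm, so the norm of the ambient finite-dimensional space is used. -/
def UniformlyBounded {Ω E : Type*} [MeasurableSpace Ω] [NormedAddCommGroup E]
    (μ : Measure Ω) (s : ℕ → Ω → E) : Prop :=
  ∃ R : ℝ, ∀ n, ∀ᵐ ω ∂μ, ‖s n ω‖ ≤ R

/-- Bounded, zero mean, independent and identically distributed random vectors. -/
structure IsWhiteNoise {Ω E : Type*} [MeasurableSpace Ω] [NormedAddCommGroup E] [NormedSpace ℝ E]
    [MeasurableSpace E] (μ : Measure Ω) (s : ℕ → Ω → E) : Prop where
  measurable : ∀ n, Measurable (s n)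
  bounded : UniformlyBounded μ s
  mean_zero : ∀ n, ∫ ω, s n ω ∂μ = 0
  indep : iIndepFun s μ
  identDistrib : ∀ n, IdentDistrib (s n) (s 0) μ μ

/-- The second moment matrix `E[ξ ξᵀ]` of a random vector (its covariance if it is centered). -/
noncomputable def secondMoment {Ω : Type*} [MeasurableSpace Ω] (μ : Measure Ω) {d : ℕ}
    (s : Ω → Fin d → ℝ) : Matrix (Fin d) (Fin d) ℝ :=
  Matrix.of fun i j => ∫ ω, s ω i * s ω j ∂μ

/-- The random inputs of the plant: process noise `w`, private excitation `e`, and the measurement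
noises `z` (of the vulnerable sensor `C₁`) and `η` (of the secure sensor `C₂`). -/
structure Inputs (Ω : Type*) (p q m : ℕ) where
  w : ℕ → Ω → Fin p → ℝ
  e : ℕ → Ω → Fin q → ℝ
  z : ℕ → Ω → Fin m → ℝ
  η : ℕ → Ω → Fin m → ℝ

structure Inputs.Admissible {Ω : Type*} [MeasurableSpace Ω] {p q m : ℕ}
    (I : Inputs Ω p q m) (μ : Measure Ω) : Prop where
  process : IsWhiteNoise μ I.w
  excitation : IsWhiteNoise μ I.e
  measurement₁ : IsWhiteNoise μ I.z
  measurement₂ : IsWhiteNoise μ I.η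
  excitation_cov : (secondMoment μ (I.e 0)).PosDef
  indep : IndepFun (fun ω n => I.w n ω) (fun ω n => (I.z n ω, I.η n ω)) μ

/-- The attacker's parameters: the gain `γ`, the disturbance `d` that drives the replayed dynamics
`ξ`, and the additive noise `ζ`. -/
structure Attack (Ω : Type*) (p m : ℕ) where
  γ : ℝ
  d : ℕ → Ω → Fin p → ℝ
  ζ : ℕ → Ω → Fin m → ℝ

/-- All signals of the attacked loop: state `x`, estimate `x'` of the switching observer, estimate
`xh` of the never switching observer, replayed state `ξ`, attack `v`, and switching signal `α`. -/
structure Signals (Ω : Type*) (p m : ℕ) where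
  x : ℕ → Ω → Fin p → ℝ
  x' : ℕ → Ω → Fin p → ℝ
  xh : ℕ → Ω → Fin p → ℝ
  ξ : ℕ → Ω → Fin p → ℝ
  v : ℕ → Ω → Fin m → ℝ
  α : ℕ → Ω → ℝ

section Tests

variable {Ω : Type*} {p q m : ℕ}

/-- The error of the never switching observer without attack:
`δ₀ = 0`, `δ_{n+1} = (A + L₁ C₁) δ_n - w_n - L₁ z_n`. -/
def nominalError (P : Plant p q m) (I : Inputs Ω p q m) : ℕ → Ω → Fin p → ℝ
  | 0, _ => 0
  | n + 1, ω => (P.A + P.L₁ * P.C₁) *ᵥ nominalError P I n ω - I.w n ω - P.L₁ *ᵥ I.z n ω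

/-- `y_n = C₁ x_n + z_n + v_n`, the measurement delivered by the vulnerable sensor. -/
def measurement (P : Plant p q m) (I : Inputs Ω p q m) (s : Signals Ω p m) (n : ℕ) (ω : Ω) :
    Fin m → ℝ :=
  P.C₁ *ᵥ s.x n ω + I.z n ω + s.v n ω

/-- The residual `C₁ x̂_n - y_n`. -/
def residual (P : Plant p q m) (I : Inputs Ω p q m) (s : Signals Ω p m) (n : ℕ) (ω : Ω) :
    Fin m → ℝ :=
  P.C₁ *ᵥ s.xh n ω - measurement P I s n ω

/-- `e_{n-k'-1}`, read as zero when the index is negative. -/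
noncomputable def delayedExcitation (P : Plant p q m) (I : Inputs Ω p q m) (n : ℕ) (ω : Ω) :
    Fin q → ℝ :=
  if P.lag + 1 ≤ n then I.e (n - (P.lag + 1)) ω else 0

/-- `Φ⁽¹⁾_N`: the empirical second moment of the residual, minus its expectation in the attack-free
system, where the residual is `C₁ δ_n - z_n`. -/
noncomputable def Phi₁ [MeasurableSpace Ω] (μ : Measure Ω) (P : Plant p q m) (I : Inputs Ω p q m)
    (s : Signals Ω p m) (N : ℕ) (ω : Ω) : Matrix (Fin m) (Fin m) ℝ :=
  (1 / (N : ℝ)) • ∑ n ∈ Finset.range N, vecMulVec (residual P I s n ω) (residual P I s n ω)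
    - (1 / (N : ℝ)) • ∑ n ∈ Finset.range N,
        secondMoment μ (fun ω' => P.C₁ *ᵥ nominalError P I n ω' - I.z n ω')

/-- `Φ⁽²⁾_N = (1/N) ∑_{n < N} (C₁ x̂_n - y_n) e_{n-k'-1}ᵀ`. -/
noncomputable def Phi₂ (P : Plant p q m) (I : Inputs Ω p q m) (s : Signals Ω p m)
    (N : ℕ) (ω : Ω) : Matrix (Fin m) (Fin q) ℝ :=
  (1 / (N : ℝ)) • ∑ n ∈ Finset.range N,
    vecMulVec (residual P I s n ω) (delayedExcitation P I n ω)

/-- `t_N = √((1 + ρ) S log N / N)`. -/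
noncomputable def threshold (ρ S : ℝ) (N : ℕ) : ℝ :=
  Real.sqrt ((1 + ρ) * S * Real.log N / N)

/-- The event `E_N` that the test reports an attack at time `N` (spectral norms). -/
def detection [MeasurableSpace Ω] (μ : Measure Ω) (P : Plant p q m) (I : Inputs Ω p q m)
    (s : Signals Ω p m) (ρ S : ℝ) (N : ℕ) : Set Ω :=
  {ω | threshold ρ S N < ‖Phi₁ μ P I s N ω‖} ∪ {ω | threshold ρ S N < ‖Phi₂ P I s N ω‖}

/-- The switching rule: start with the accurate sensor; use the secure sensor whenever a threshold
is violated; otherwise keep the current sensor, except that the accurate sensor is taken up again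
once the secure one has been used during the last `τ` steps. -/
structure SwitchingRule [MeasurableSpace Ω] (μ : Measure Ω) (P : Plant p q m) (I : Inputs Ω p q m)
    (s : Signals Ω p m) (ρ S : ℝ) (τ : ℕ) : Prop where
  init : ∀ ω, s.α 0 ω = 1
  violated : ∀ N ω, 1 ≤ N →
    (threshold ρ S N ≤ ‖Phi₁ μ P I s N ω‖ ∨ threshold ρ S N ≤ ‖Phi₂ P I s N ω‖) → s.α N ω = 0
  keep : ∀ N ω, 1 ≤ N →
    ‖Phi₁ μ P I s N ω‖ < threshold ρ S N → ‖Phi₂ P I s N ω‖ < threshold ρ S N →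
    ¬ (s.α (N - 1) ω = 0 ∧ τ ≤ N ∧ ∀ i ∈ Finset.Icc 1 τ, s.α (N - i) ω = 0) →
    s.α N ω = s.α (N - 1) ω
  return_ : ∀ N ω, 1 ≤ N →
    ‖Phi₁ μ P I s N ω‖ < threshold ρ S N → ‖Phi₂ P I s N ω‖ < threshold ρ S N →
    (s.α (N - 1) ω = 0 ∧ τ ≤ N ∧ ∀ i ∈ Finset.Icc 1 τ, s.α (N - i) ω = 0) →
    s.α N ω = 1

/-- The equations of the attacked loop. The input is `u_n = K x'_n + e_n`. The switching observer
sees `C(α_n) x_n + α_n z_n + (1 - α_n) η_n + α_n v_n`; the other one always sees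
`y_n = C₁ x_n + z_n + v_n`. -/
structure ClosedLoop (P : Plant p q m) (I : Inputs Ω p q m) (a : Attack Ω p m)
    (s : Signals Ω p m) : Prop where
  state : ∀ n ω, s.x (n + 1) ω =
    P.A *ᵥ s.x n ω + P.B *ᵥ (P.K *ᵥ s.x' n ω + I.e n ω) + I.w n ω
  switching_observer : ∀ n ω, s.x' (n + 1) ω =
    P.A *ᵥ s.x' n ω + P.B *ᵥ (P.K *ᵥ s.x' n ω + I.e n ω)
      + P.L (s.α n ω) *ᵥ (P.C (s.α n ω) *ᵥ s.x' n ω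
        - (P.C (s.α n ω) *ᵥ s.x n ω + (s.α n ω • I.z n ω + (1 - s.α n ω) • I.η n ω)
          + s.α n ω • s.v n ω))
  fixed_observer_init : ∀ ω, s.xh 0 ω = s.x 0 ω
  fixed_observer : ∀ n ω, s.xh (n + 1) ω =
    P.A *ᵥ s.xh n ω + P.B *ᵥ (P.K *ᵥ s.x' n ω + I.e n ω) + P.L₁ *ᵥ residual P I s n ω
  replay : ∀ n ω, s.ξ (n + 1) ω = (P.A + P.B * P.K) *ᵥ s.ξ n ω + a.d n ω
  attack : ∀ n ω, s.v n ω =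
    P.C₁ *ᵥ s.ξ n ω + a.ζ n ω - a.γ • (P.C₁ *ᵥ s.x n ω + I.z n ω)

/-- The attacker's signals and the initial conditions are measurable, the attacker's signals are
bounded, and the private excitation is independent of everything else. -/
structure PrivateExcitation [MeasurableSpace Ω] (μ : Measure Ω) (I : Inputs Ω p q m)
    (a : Attack Ω p m) (s : Signals Ω p m) : Prop where
  measurable_d : ∀ n, Measurable (a.d n)
  measurable_ζ : ∀ n, Measurable (a.ζ n)
  bounded_d : UniformlyBounded μ a.d
  bounded_ζ : UniformlyBounded μ a.ζ
  measurable_x : Measurable (s.x 0)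
  measurable_x' : Measurable (s.x' 0)
  measurable_ξ : Measurable (s.ξ 0)
  indep : IndepFun (fun ω n => I.e n ω)
    (fun ω => ((s.x 0 ω, s.x' 0 ω, s.ξ 0 ω),
      fun n => (I.w n ω, I.z n ω, I.η n ω, a.d n ω, a.ζ n ω))) μ

/-- The pairs `(d_n, ζ_n)` are bounded, centered and i.i.d. over time, and independent of the noises
of the plant. -/
structure Attack.IsWhite [MeasurableSpace Ω] (a : Attack Ω p m) (μ : Measure Ω)
    (I : Inputs Ω p q m) : Prop where
  white : IsWhiteNoise μ (fun n ω => (a.d n ω, a.ζ n ω))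
  indep : IndepFun (fun ω n => (a.d n ω, a.ζ n ω)) (fun ω n => (I.w n ω, I.z n ω, I.η n ω)) μ

/-- The attack has zero average power: `(1/N) ∑_{n < N} v_nᵀ v_n → 0` almost surely. -/
def ZeroAveragePower [MeasurableSpace Ω] (μ : Measure Ω) (v : ℕ → Ω → Fin m → ℝ) : Prop :=
  ∀ᵐ ω ∂μ, Tendsto (fun N : ℕ => (1 / (N : ℝ)) * ∑ n ∈ Finset.range N, v n ω ⬝ᵥ v n ω)
    atTop (𝓝 0)

end Tests

end Watermark

/-!
The statistics stay away from zero almost surely, whereas the thresholds `t_N` tend to zero.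

For `γ ≠ 0`, the excitation `e_n` enters the measurement `k' + 1` steps later with the coefficient
`C (A + B K) ^ k' B`, and the attack perturbs it there by the factor `-γ`; the rest of the residual
is independent of `e_n`. The correlation of that rest with the excitation is a martingale transform,
hence negligible against the energy of the residual. As long as `Φ⁽¹⁾` is bounded, so is the average
energy, and `Φ⁽²⁾` is then asymptotic to `γ C (A + B K) ^ k' B Σ_E`, which is not zero.

For `γ = 0`, the residual is asymptotic to the attack-free one plus the linear response to the
attack disturbances, which is independent of it and centered. By the law of large numbers for
quadratic functionals of a stable linear recursion, the trace of `Φ⁽¹⁾` is asymptotic to the average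
variance of this response. It is bounded below by the variance of any single term of the impulse
response; if all of these vanish, then `v_n = C (A + B K) ^ n ξ_0` has zero average power, and is
zero when `ξ_0` is.
-/

namespace Watermark

section UniformlyBounded

variable {Ω E E' : Type*} [MeasurableSpace Ω] {μ : Measure Ω}
  [NormedAddCommGroup E] [NormedAddCommGroup E'] {s : ℕ → Ω → E} {t : ℕ → Ω → E'}

theorem UniformlyBounded.exists_ae_forall_norm_le (hs : UniformlyBounded μ s) :
    ∃ R, 0 ≤ R ∧ ∀ᵐ ω ∂μ, ∀ n, ‖s n ω‖ ≤ R := by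
  obtain ⟨R, hR⟩ := hs
  refine ⟨max R 0, le_max_right _ _, ?_⟩
  filter_upwards [ae_all_iff.2 hR] with ω hω n using (hω n).trans (le_max_left _ _)

theorem UniformlyBounded.prodMk (hs : UniformlyBounded μ s) (ht : UniformlyBounded μ t) :
    UniformlyBounded μ fun n ω => (s n ω, t n ω) := by
  obtain ⟨R, hR⟩ := hs
  obtain ⟨R', hR'⟩ := ht
  refine ⟨max R R', fun n => ?_⟩
  filter_upwards [hR n, hR' n] with ω h h' using max_le_max h h'

theorem UniformlyBounded.continuous_comp [ProperSpace E] (hs : UniformlyBounded μ s) {f : E → E'}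
    (hf : Continuous f) : UniformlyBounded μ fun n ω => f (s n ω) := by
  obtain ⟨R, hR⟩ := hs
  obtain ⟨R', hR'⟩ := (isCompact_closedBall (0 : E) R).exists_bound_of_continuousOn hf.continuousOn
  exact ⟨R', fun n => (hR n).mono fun ω hω => hR' _ (mem_closedBall_zero_iff.2 hω)⟩

theorem UniformlyBounded.memLp_top (hs : UniformlyBounded μ s) {n : ℕ}
    (hm : AEStronglyMeasurable (s n) μ) : MemLp (s n) ⊤ μ := by
  obtain ⟨R, hR⟩ := hs
  exact memLp_top_of_bound hm R (hR n)

theorem UniformlyBounded.integrable [IsFiniteMeasure μ] (hs : UniformlyBounded μ s) {n : ℕ}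
    (hm : AEStronglyMeasurable (s n) μ) : Integrable (s n) μ :=
  (hs.memLp_top hm).integrable le_top

theorem UniformlyBounded.exists_norm_integral_le [NormedSpace ℝ E] [IsProbabilityMeasure μ]
    (hs : UniformlyBounded μ s) : ∃ R, ∀ n, ‖∫ ω, s n ω ∂μ‖ ≤ R := by
  obtain ⟨R, hR⟩ := hs
  exact ⟨R, fun n => by simpa using norm_integral_le_of_norm_le_const (hR n)⟩

end UniformlyBounded

section Independence

variable {Ω : Type*} {mΩ : MeasurableSpace Ω} {μ : Measure Ω}

theorem iIndep_sumElim {ι κ : Type*} {m₁ : ι → MeasurableSpace Ω} {m₂ : κ → MeasurableSpace Ω}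
    (h₁ : iIndep m₁ μ) (h₂ : iIndep m₂ μ) (h : Indep (⨆ i, m₁ i) (⨆ j, m₂ j) μ) :
    iIndep (Sum.elim m₁ m₂) μ := by
  rw [iIndep_iff]
  intro s f hf
  have hleft : ∀ i ∈ s.toLeft, MeasurableSet[m₁ i] (f (Sum.inl i)) := fun i hi =>
    hf (Sum.inl i) (Finset.mem_toLeft.1 hi)
  have hright : ∀ j ∈ s.toRight, MeasurableSet[m₂ j] (f (Sum.inr j)) := fun j hj =>
    hf (Sum.inr j) (Finset.mem_toRight.1 hj)
  have hinter : ⋂ i ∈ s, f i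
      = (⋂ i ∈ s.toLeft, f (Sum.inl i)) ∩ ⋂ j ∈ s.toRight, f (Sum.inr j) := by
    ext ω
    simp only [Set.mem_iInter, Set.mem_inter_iff, Finset.mem_toLeft, Finset.mem_toRight,
      Sum.forall]
  rw [hinter, (Indep_iff _ _ _).1 h _ _
    (Finset.measurableSet_biInter _ fun i hi => le_iSup m₁ i _ (hleft i hi))
    (Finset.measurableSet_biInter _ fun j hj => le_iSup m₂ j _ (hright j hj)),
    h₁.meas_biInter hleft, h₂.meas_biInter hright,
    ← Finset.prod_disjSum s.toLeft s.toRight fun k => μ (f k), Finset.toLeft_disjSum_toRight]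

theorem indepFun_of_indep {E E' : Type*} [MeasurableSpace E] [MeasurableSpace E']
    {m₁ m₂ : MeasurableSpace Ω} (h : Indep m₁ m₂ μ) {f : Ω → E} {g : Ω → E'}
    (hf : Measurable[m₁] f) (hg : Measurable[m₂] g) : IndepFun f g μ :=
  (IndepFun_iff_Indep _ _ _).2 (indep_of_indep_of_le h hf.comap_le hg.comap_le)

theorem integral_mul_eq_zero_of_indep {m₁ m₂ : MeasurableSpace Ω} (h : Indep m₁ m₂ μ)
    (h₁ : m₁ ≤ mΩ) (h₂ : m₂ ≤ mΩ) {f g : Ω → ℝ} (hf : Measurable[m₁] f) (hg : Measurable[m₂] g)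
    (hf0 : ∫ ω, f ω ∂μ = 0) : ∫ ω, g ω * f ω ∂μ = 0 := by
  rw [(indepFun_of_indep h hf hg).symm.integral_fun_mul_eq_mul_integral
    (hg.mono h₂ le_rfl).aestronglyMeasurable (hf.mono h₁ le_rfl).aestronglyMeasurable,
    hf0, mul_zero]

/-- The information `G n` that arrives between the times `n` and `n + 1` is independent of the
information `F n` that is available at time `n`. -/
structure IsInnovation (μ : Measure Ω) (F : Filtration ℕ mΩ) (G : ℕ → MeasurableSpace Ω) :
    Prop where
  le_succ : ∀ n, G n ≤ F (n + 1)
  indep : ∀ n, Indep (G n) (F n) μ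

theorem IsInnovation.le {F : Filtration ℕ mΩ} {G : ℕ → MeasurableSpace Ω}
    (hG : IsInnovation μ F G) (n : ℕ) : G n ≤ mΩ :=
  (hG.le_succ n).trans (F.le _)

/-- Bounded centered random vectors `b n`, the `n`-th of which is measurable with respect to the
σ-algebra `G n`. -/
structure BoundedCentered {E : Type*} [NormedAddCommGroup E] [NormedSpace ℝ E]
    [MeasurableSpace E] (μ : Measure Ω) (G : ℕ → MeasurableSpace Ω) (b : ℕ → Ω → E) : Prop where
  measurable : ∀ n, Measurable[G n] (b n)
  bounded : UniformlyBounded μ b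
  mean_zero : ∀ n, ∫ ω, b n ω ∂μ = 0

theorem integral_linearMap_comp {E E' : Type*} [NormedAddCommGroup E] [NormedSpace ℝ E]
    [FiniteDimensional ℝ E] [NormedAddCommGroup E'] [NormedSpace ℝ E'] [FiniteDimensional ℝ E']
    {X : Ω → E} (hX : Integrable X μ) (f : E →ₗ[ℝ] E') :
    ∫ ω, f (X ω) ∂μ = f (∫ ω, X ω ∂μ) :=
  haveI := FiniteDimensional.complete ℝ E
  haveI := FiniteDimensional.complete ℝ E'
  f.toContinuousLinearMap.integral_comp_comm hX

section Closure

variable {E E' : Type*} [NormedAddCommGroup E] [NormedSpace ℝ E] [FiniteDimensional ℝ E]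
  [MeasurableSpace E] [BorelSpace E] [NormedAddCommGroup E'] [NormedSpace ℝ E']
  [FiniteDimensional ℝ E'] [MeasurableSpace E'] [BorelSpace E'] {b : ℕ → Ω → E}
  {G : ℕ → MeasurableSpace Ω} [IsFiniteMeasure μ]

theorem BoundedCentered.integrable (hb : BoundedCentered μ G b) (hG : ∀ n, G n ≤ mΩ) (n : ℕ) :
    Integrable (b n) μ :=
  hb.bounded.integrable ((hb.measurable n).mono (hG n) le_rfl).aestronglyMeasurable

theorem BoundedCentered.linearMap_comp (hb : BoundedCentered μ G b) (hG : ∀ n, G n ≤ mΩ)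
    (f : E →ₗ[ℝ] E') : BoundedCentered μ G fun n ω => f (b n ω) where
  measurable n := f.continuous_of_finiteDimensional.measurable.comp (hb.measurable n)
  bounded := hb.bounded.continuous_comp f.continuous_of_finiteDimensional
  mean_zero n := by rw [integral_linearMap_comp (hb.integrable hG n), hb.mean_zero, map_zero]

theorem BoundedCentered.prodMk {b' : ℕ → Ω → E'} (hb : BoundedCentered μ G b)
    (hb' : BoundedCentered μ G b') (hG : ∀ n, G n ≤ mΩ) :
    BoundedCentered μ G fun n ω => (b n ω, b' n ω) where
  measurable n := (hb.measurable n).prodMk (hb'.measurable n)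
  bounded := hb.bounded.prodMk hb'.bounded
  mean_zero n := by
    rw [integral_pair (hb.integrable hG n) (hb'.integrable hG n), hb.mean_zero, hb'.mean_zero,
      Prod.mk_zero_zero]

end Closure

/-- The filtration generated by a family of σ-algebras, the `k`-th of which is revealed at the time
`t k`. -/
def past {κ : Type*} (m : κ → MeasurableSpace Ω) (hm : ∀ k, m k ≤ mΩ) (t : κ → ℕ) :
    Filtration ℕ mΩ where
  seq n := ⨆ k ∈ {k | t k ≤ n}, m k
  mono' _ _ hij := biSup_mono fun _ (hk : _ ≤ _) => hk.trans hij
  le' _ := iSup₂_le fun k _ => hm k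

/-- The σ-algebra generated by those members of a family that are revealed exactly at time
`n + 1`. -/
abbrev innovation {κ : Type*} (m : κ → MeasurableSpace Ω) (t : κ → ℕ) (n : ℕ) : MeasurableSpace Ω :=
  ⨆ k ∈ {k | t k = n + 1}, m k

section Past

variable {κ : Type*} {m : κ → MeasurableSpace Ω} {hm : ∀ k, m k ≤ mΩ} {t : κ → ℕ}

theorem le_past {k : κ} {n : ℕ} (h : t k ≤ n) : m k ≤ past m hm t n :=
  le_iSup₂_of_le (f := fun k (_ : k ∈ {k | t k ≤ n}) => m k) k h le_rfl

theorem le_innovation {k : κ} {n : ℕ} (h : t k = n + 1) : m k ≤ innovation m t n :=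
  le_iSup₂_of_le (f := fun k (_ : k ∈ {k | t k = n + 1}) => m k) k h le_rfl

theorem isInnovation_past (h : iIndep m μ) : IsInnovation μ (past m hm t) (innovation m t) where
  le_succ _ := biSup_mono fun _ (hk : _ = _) => hk.le
  indep n := indep_iSup_of_disjoint hm h <| Set.disjoint_left.2 fun k hk hk' => by
    simp only [Set.mem_ofPred_eq] at hk hk'
    omega

end Past

end Independence

section Energy

theorem tendsto_sum_mul_div_of_tendsto_sum {a A : ℕ → ℝ} (hA : Monotone A) (hpos : ∀ n, 0 < A n)
    (htop : Tendsto A atTop atTop) {c : ℝ}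
    (hc : Tendsto (fun n => ∑ k ∈ Finset.range n, a k) atTop (𝓝 c)) :
    Tendsto (fun n => (∑ k ∈ Finset.range n, A (k + 1) * a k) / A n) atTop (𝓝 0) := by
  set S : ℕ → ℝ := fun n => ∑ k ∈ Finset.range n, a k with hS
  have abel (n : ℕ) : ∑ k ∈ Finset.range n, A (k + 1) * a k
      = A n * (S n - c) + A 0 * c - ∑ k ∈ Finset.range n, (A (k + 1) - A k) * (S k - c) := by
    induction n with
    | zero => simp [hS]
    | succ n ih =>
      have hSn : S (n + 1) = S n + a n := Finset.sum_range_succ _ _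
      rw [Finset.sum_range_succ, ih, Finset.sum_range_succ, hSn]
      ring
  have hSc : Tendsto (fun n => S n - c) atTop (𝓝 0) := by simpa using hc.sub_const c
  have htel (n : ℕ) : ∑ k ∈ Finset.range n, (A (k + 1) - A k) = A n - A 0 :=
    Finset.sum_range_sub _ _
  have hincr : (fun k => (A (k + 1) - A k) * (S k - c)) =o[atTop] fun k => A (k + 1) - A k := by
    simpa using (Asymptotics.isBigO_refl (fun k => A (k + 1) - A k) atTop).mul_isLittleO
      ((Asymptotics.isLittleO_one_iff ℝ).2 hSc)
  have hsum := hincr.sum_range (fun k => sub_nonneg.2 (hA k.le_succ))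
    (by simp only [htel]; exact tendsto_atTop_add_const_right _ _ htop)
  have hbig : (fun n => ∑ k ∈ Finset.range n, (A (k + 1) - A k)) =O[atTop] A := by
    refine Asymptotics.IsBigO.of_bound 1 (Eventually.of_forall fun n => ?_)
    rw [htel, Real.norm_of_nonneg (sub_nonneg.2 (hA n.zero_le)), Real.norm_of_nonneg (hpos n).le]
    linarith [hpos 0]
  have hlim := (hSc.add (tendsto_const_nhds (x := A 0 * c).div_atTop htop)).sub
    (hsum.trans_isBigO hbig).tendsto_div_nhds_zero
  rw [add_zero, sub_zero] at hlim
  refine hlim.congr fun n => ?_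
  rw [abel]
  field_simp [(hpos n).ne']

/-- The normalization `1 + N + ∑_{n < N} q_n²` of a martingale transform with coefficients `q`. -/
def energy (q : ℕ → ℝ) (N : ℕ) : ℝ := 1 + N + ∑ n ∈ Finset.range N, q n ^ 2

theorem energy_succ (q : ℕ → ℝ) (N : ℕ) : energy q (N + 1) = energy q N + 1 + q N ^ 2 := by
  simp only [energy, Finset.sum_range_succ, Nat.cast_add_one]
  ring

theorem one_add_le_energy (q : ℕ → ℝ) (N : ℕ) : 1 + (N : ℝ) ≤ energy q N :=
  le_add_of_nonneg_right (Finset.sum_nonneg fun _ _ => sq_nonneg _)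

theorem energy_pos (q : ℕ → ℝ) (N : ℕ) : 0 < energy q N :=
  lt_of_lt_of_le (by positivity) (one_add_le_energy q N)

theorem monotone_energy (q : ℕ → ℝ) : Monotone (energy q) :=
  monotone_nat_of_le_succ fun n => by
    rw [energy_succ]
    linarith [sq_nonneg (q n)]

theorem tendsto_energy_atTop (q : ℕ → ℝ) : Tendsto (energy q) atTop atTop :=
  tendsto_atTop_mono (one_add_le_energy q)
    (tendsto_atTop_add_const_left _ _ tendsto_natCast_atTop_atTop)

theorem abs_div_energy_succ_le_one (q : ℕ → ℝ) (n : ℕ) : |q n / energy q (n + 1)| ≤ 1 := by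
  rw [abs_div, abs_of_pos (energy_pos q _), div_le_one (energy_pos q _), energy_succ]
  nlinarith [energy_pos q n, sq_abs (q n), sq_nonneg (|q n| - 1)]

theorem sq_div_energy_succ_le (q : ℕ → ℝ) (n : ℕ) :
    (q n / energy q (n + 1)) ^ 2 ≤ 1 / energy q n - 1 / energy q (n + 1) := by
  have hpos := energy_pos q n
  have hpos' := energy_pos q (n + 1)
  have hle : energy q n ≤ energy q (n + 1) := monotone_energy q n.le_succ
  have hsq : q n ^ 2 ≤ energy q (n + 1) - energy q n := by linarith [energy_succ q n]
  rw [div_sub_div _ _ hpos.ne' hpos'.ne', div_pow, div_le_div_iff₀ (by positivity) (by positivity)]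
  nlinarith [mul_le_mul hsq hle hpos.le (sub_nonneg.2 hle)]

theorem sum_sq_div_energy_succ_le_one (q : ℕ → ℝ) (N : ℕ) :
    ∑ n ∈ Finset.range N, (q n / energy q (n + 1)) ^ 2 ≤ 1 :=
  calc ∑ n ∈ Finset.range N, (q n / energy q (n + 1)) ^ 2
      ≤ ∑ n ∈ Finset.range N, (1 / energy q n - 1 / energy q (n + 1)) :=
        Finset.sum_le_sum fun n _ => sq_div_energy_succ_le q n
    _ = 1 - 1 / energy q N := by rw [Finset.sum_range_sub']; simp [energy]
    _ ≤ 1 := sub_le_self _ (one_div_pos.2 (energy_pos q N)).le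

end Energy

section MartingaleTransform

variable {Ω : Type*} {mΩ : MeasurableSpace Ω} {μ : Measure Ω}
  {F : Filtration ℕ mΩ} {G : ℕ → MeasurableSpace Ω} {a h : ℕ → Ω → ℝ}

/-- The martingale transform `∑_{k < n} a_k h_k` of innovations `h` by predictable coefficients
`a`. -/
def martingaleTransform (a h : ℕ → Ω → ℝ) (n : ℕ) (ω : Ω) : ℝ :=
  ∑ k ∈ Finset.range n, a k ω * h k ω

theorem martingaleTransform_succ (a h : ℕ → Ω → ℝ) (n : ℕ) (ω : Ω) :
    martingaleTransform a h (n + 1) ω = martingaleTransform a h n ω + a n ω * h n ω :=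
  Finset.sum_range_succ _ _

theorem IsInnovation.measurable_martingaleTransform (hG : IsInnovation μ F G)
    (ha : ∀ n, Measurable[F n] (a n)) (hh : ∀ n, Measurable[G n] (h n)) (n : ℕ) :
    Measurable[F n] (martingaleTransform a h n) :=
  Finset.measurable_sum _ fun k hk =>
    have hkn : k + 1 ≤ n := Finset.mem_range.1 hk
    ((ha k).mono (F.mono (k.le_succ.trans hkn)) le_rfl).mul
      ((hh k).mono ((hG.le_succ k).trans (F.mono hkn)) le_rfl)

theorem IsInnovation.memLp_top (hG : IsInnovation μ F G) (hh : BoundedCentered μ G h) (n : ℕ) :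
    MemLp (h n) ⊤ μ :=
  hh.bounded.memLp_top ((hh.measurable n).mono (hG.le n) le_rfl).aestronglyMeasurable

theorem memLp_top_martingaleTransform (ha : ∀ n, MemLp (a n) ⊤ μ) (hh : ∀ n, MemLp (h n) ⊤ μ)
    (n : ℕ) : MemLp (martingaleTransform a h n) ⊤ μ :=
  memLp_finsetSum _ fun k _ => (hh k).mul (ha k)

variable [IsProbabilityMeasure μ]

theorem IsInnovation.martingale_martingaleTransform (hG : IsInnovation μ F G)
    (ha : ∀ n, Measurable[F n] (a n)) (ha' : ∀ n, MemLp (a n) ⊤ μ)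
    (hh : BoundedCentered μ G h) : Martingale (martingaleTransform a h) F μ := by
  have hh' := hG.memLp_top hh
  refine martingale_of_condExp_sub_eq_zero_nat
    (fun n => (hG.measurable_martingaleTransform ha hh.measurable n).stronglyMeasurable)
    (fun n => (memLp_top_martingaleTransform ha' hh' n).integrable le_top) fun n => ?_
  have hincr : martingaleTransform a h (n + 1) - martingaleTransform a h n = a n * h n := by
    funext ω
    simp only [Pi.sub_apply, Pi.mul_apply, martingaleTransform_succ, add_sub_cancel_left]
  have hpull := condExp_mul_of_stronglyMeasurable_left (ha n).stronglyMeasurable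
    (((hh' n).mul (ha' n)).integrable le_top) ((hh' n).integrable le_top)
  have hmean := condExp_indep_eq (hG.le n) (F.le n) (hh.measurable n).stronglyMeasurable
    (hG.indep n)
  rw [hincr]
  filter_upwards [hpull, hmean] with ω hω hω'
  rw [hω, Pi.mul_apply, hω', hh.mean_zero, mul_zero, Pi.zero_apply]

theorem IsInnovation.integral_sq_martingaleTransform_succ (hG : IsInnovation μ F G)
    (ha : ∀ n, Measurable[F n] (a n)) (ha' : ∀ n, MemLp (a n) ⊤ μ)
    (hh : BoundedCentered μ G h) (n : ℕ) :
    ∫ ω, martingaleTransform a h (n + 1) ω ^ 2 ∂μ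
      = ∫ ω, martingaleTransform a h n ω ^ 2 ∂μ + ∫ ω, (a n ω * h n ω) ^ 2 ∂μ := by
  have hh' := hG.memLp_top hh
  have hS := memLp_top_martingaleTransform ha' hh' n
  have hah : MemLp (fun ω => a n ω * h n ω) ⊤ μ := (hh' n).mul (ha' n)
  have hsq : Integrable (fun ω => martingaleTransform a h n ω ^ 2) μ :=
    (hS.mono_exponent le_top).integrable_sq
  have hcross : Integrable (fun ω => 2 * (martingaleTransform a h n ω * a n ω) * h n ω) μ :=
    ((hh' n).mul (((ha' n).mul (r := ⊤) hS).const_mul 2) : MemLp _ ⊤ μ).integrable le_top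
  have horth : ∫ ω, 2 * (martingaleTransform a h n ω * a n ω) * h n ω ∂μ = 0 :=
    integral_mul_eq_zero_of_indep (hG.indep n) (hG.le n) (F.le n) (hh.measurable n)
      (((hG.measurable_martingaleTransform ha hh.measurable n).mul (ha n)).const_mul 2)
      (hh.mean_zero n)
  have hexpand (ω : Ω) : martingaleTransform a h (n + 1) ω ^ 2 = martingaleTransform a h n ω ^ 2
      + 2 * (martingaleTransform a h n ω * a n ω) * h n ω + (a n ω * h n ω) ^ 2 := by
    rw [martingaleTransform_succ]
    ring
  simp only [hexpand]
  rw [integral_add (by exact hsq.add hcross) (hah.mono_exponent le_top).integrable_sq,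
    integral_add hsq hcross, horth, add_zero]

theorem IsInnovation.integral_sq_martingaleTransform_le (hG : IsInnovation μ F G)
    (ha : ∀ n, Measurable[F n] (a n)) (ha' : ∀ n, MemLp (a n) ⊤ μ)
    (hh : BoundedCentered μ G h) {R : ℝ} (hR : ∀ᵐ ω ∂μ, ∀ n, ‖h n ω‖ ≤ R) (n : ℕ) :
    ∫ ω, martingaleTransform a h n ω ^ 2 ∂μ
      ≤ R ^ 2 * ∫ ω, ∑ k ∈ Finset.range n, a k ω ^ 2 ∂μ := by
  have hsq (k : ℕ) : Integrable (fun ω => a k ω ^ 2) μ :=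
    ((ha' k).mono_exponent le_top).integrable_sq
  induction n with
  | zero => simp [martingaleTransform]
  | succ n ih =>
    have hah : MemLp (fun ω => a n ω * h n ω) ⊤ μ := (hG.memLp_top hh n).mul (ha' n)
    have hterm : ∫ ω, (a n ω * h n ω) ^ 2 ∂μ ≤ R ^ 2 * ∫ ω, a n ω ^ 2 ∂μ := by
      rw [← integral_const_mul]
      refine integral_mono_ae (hah.mono_exponent le_top).integrable_sq ((hsq n).const_mul _) ?_
      filter_upwards [hR] with ω hω
      rw [mul_pow, mul_comm]
      exact mul_le_mul_of_nonneg_right (sq_le_sq.2 ((hω n).trans (le_abs_self R))) (sq_nonneg _)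
    simp only [Finset.sum_range_succ]
    rw [hG.integral_sq_martingaleTransform_succ ha ha' hh,
      integral_add (integrable_finsetSum _ fun k _ => hsq k) (hsq n), mul_add]
    exact add_le_add ih hterm

theorem IsInnovation.ae_exists_tendsto_martingaleTransform (hG : IsInnovation μ F G)
    (ha : ∀ n, Measurable[F n] (a n)) (ha' : ∀ n, MemLp (a n) ⊤ μ) {C : ℝ}
    (hC : ∀ n ω, ∑ k ∈ Finset.range n, a k ω ^ 2 ≤ C) (hh : BoundedCentered μ G h) :
    ∀ᵐ ω ∂μ, ∃ c, Tendsto (fun n => martingaleTransform a h n ω) atTop (𝓝 c) := by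
  obtain ⟨R, -, hR⟩ := hh.bounded.exists_ae_forall_norm_le
  have hS := memLp_top_martingaleTransform ha' (hG.memLp_top hh)
  have hsq (n : ℕ) : Integrable (fun ω => martingaleTransform a h n ω ^ 2) μ :=
    ((hS n).mono_exponent le_top).integrable_sq
  have henergy (n : ℕ) : ∫ ω, ∑ k ∈ Finset.range n, a k ω ^ 2 ∂μ ≤ C := by
    refine (integral_mono_of_nonneg (Eventually.of_forall fun ω => ?_) (integrable_const C)
      (Eventually.of_forall fun ω => hC n ω)).trans (by simp)
    exact Finset.sum_nonneg fun _ _ => sq_nonneg _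
  have habs (n : ℕ) : ∫ ω, ‖martingaleTransform a h n ω‖ ∂μ ≤ 1 + R ^ 2 * C :=
    calc ∫ ω, ‖martingaleTransform a h n ω‖ ∂μ
        ≤ ∫ ω, (1 + martingaleTransform a h n ω ^ 2) ∂μ := by
          refine integral_mono ((hS n).integrable le_top).norm ((integrable_const 1).add (hsq n))
            fun ω => ?_
          simp only [Real.norm_eq_abs]
          nlinarith [sq_nonneg (|martingaleTransform a h n ω| - 1),
            sq_abs (martingaleTransform a h n ω)]
      _ = 1 + ∫ ω, martingaleTransform a h n ω ^ 2 ∂μ := by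
          rw [integral_add (integrable_const 1) (hsq n)]
          simp
      _ ≤ 1 + R ^ 2 * C := by
          have := hG.integral_sq_martingaleTransform_le ha ha' hh hR n
          gcongr
          exact this.trans (mul_le_mul_of_nonneg_left (henergy n) (sq_nonneg R))
  refine (hG.martingale_martingaleTransform ha ha' hh).submartingale.exists_ae_tendsto_of_bdd
    (R := (1 + R ^ 2 * C).toNNReal) fun n => ?_
  rw [eLpNorm_one_eq_lintegral_enorm,
    ← ofReal_integral_norm_eq_lintegral_enorm ((hS n).integrable le_top)]
  exact ENNReal.ofReal_le_ofReal (habs n)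

theorem IsInnovation.tendsto_martingaleTransform_div_energy (hG : IsInnovation μ F G)
    {q : ℕ → Ω → ℝ} (hq : ∀ n, Measurable[F n] (q n)) (hh : BoundedCentered μ G h) :
    ∀ᵐ ω ∂μ, Tendsto (fun N => martingaleTransform q h N ω / energy (fun n => q n ω) N)
      atTop (𝓝 0) := by
  set a : ℕ → Ω → ℝ := fun n ω => q n ω / energy (fun k => q k ω) (n + 1) with ha_def
  have ha (n : ℕ) : Measurable[F n] (a n) := by
    refine (hq n).div (measurable_const.add (Finset.measurable_sum _ fun k hk => ?_))
    exact ((hq k).mono (F.mono (Nat.lt_succ_iff.1 (Finset.mem_range.1 hk))) le_rfl).pow_const 2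
  have ha' (n : ℕ) : MemLp (a n) ⊤ μ :=
    memLp_top_of_bound ((ha n).mono (F.le n) le_rfl).aestronglyMeasurable 1
      (Eventually.of_forall fun ω => abs_div_energy_succ_le_one (fun k => q k ω) n)
  filter_upwards [hG.ae_exists_tendsto_martingaleTransform ha ha'
    (fun n ω => sum_sq_div_energy_succ_le_one (fun k => q k ω) n) hh] with ω ⟨c, hc⟩
  refine (tendsto_sum_mul_div_of_tendsto_sum (monotone_energy _) (energy_pos _)
    (tendsto_energy_atTop fun n => q n ω) hc).congr fun N => ?_
  simp only [martingaleTransform, ha_def]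
  congr 1
  refine Finset.sum_congr rfl fun k _ => ?_
  field_simp [(energy_pos (fun n => q n ω) (k + 1)).ne']

end MartingaleTransform

section LawOfLargeNumbers

variable {Ω : Type*} {mΩ : MeasurableSpace Ω} {μ : Measure Ω}
  {F : Filtration ℕ mΩ} {G : ℕ → MeasurableSpace Ω}

theorem tendsto_inv_mul_of_abs_le {u : ℕ → ℝ} {R : ℝ} (h : ∀ n, |u n| ≤ R) :
    Tendsto (fun N : ℕ => (N : ℝ)⁻¹ * u N) atTop (𝓝 0) :=
  tendsto_inv_atTop_nhds_zero_nat.zero_mul_isBoundedUnder_le (isBoundedUnder_of ⟨R, h⟩)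

/-- The strong law of large numbers for random variables that need be neither independent nor
identically distributed: almost surely, the time averages of the deviations from the means tend to
zero. -/
structure SatisfiesLLN (μ : Measure Ω) (Y : ℕ → Ω → ℝ) : Prop where
  integrable : ∀ n, Integrable (Y n) μ
  tendsto : ∀ᵐ ω ∂μ, Tendsto
    (fun N : ℕ => (N : ℝ)⁻¹ * ∑ n ∈ Finset.range N, (Y n ω - ∫ ω', Y n ω' ∂μ)) atTop (𝓝 0)

theorem SatisfiesLLN.add {X Y : ℕ → Ω → ℝ} (hX : SatisfiesLLN μ X) (hY : SatisfiesLLN μ Y) :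
    SatisfiesLLN μ fun n ω => X n ω + Y n ω where
  integrable n := (hX.integrable n).add (hY.integrable n)
  tendsto := by
    filter_upwards [hX.tendsto, hY.tendsto] with ω hω hω'
    have hsum := hω.add hω'
    rw [add_zero] at hsum
    refine hsum.congr fun N => ?_
    rw [← mul_add, ← Finset.sum_add_distrib]
    simp only [integral_add (hX.integrable _) (hY.integrable _), add_sub_add_comm]

theorem SatisfiesLLN.sum {ι : Type*} {Y : ι → ℕ → Ω → ℝ} (s : Finset ι)
    (hY : ∀ i ∈ s, SatisfiesLLN μ (Y i)) : SatisfiesLLN μ fun n ω => ∑ i ∈ s, Y i n ω where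
  integrable n := integrable_finsetSum _ fun i hi => (hY i hi).integrable n
  tendsto := by
    filter_upwards [s.eventually_all.2 fun i hi => (hY i hi).tendsto] with ω hω
    have hsum := tendsto_finsetSum s hω
    rw [Finset.sum_const_zero] at hsum
    refine hsum.congr fun N => ?_
    rw [← Finset.mul_sum, Finset.sum_comm]
    simp only [integral_finsetSum s fun i hi => (hY i hi).integrable _, Finset.sum_sub_distrib]

theorem SatisfiesLLN.tendsto_average {Y : ℕ → Ω → ℝ} (hY : SatisfiesLLN μ Y) {c : ℝ}
    (hc : ∀ n, ∫ ω, Y n ω ∂μ = c) :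
    ∀ᵐ ω ∂μ, Tendsto (fun N : ℕ => (N : ℝ)⁻¹ * ∑ n ∈ Finset.range N, Y n ω) atTop (𝓝 c) := by
  filter_upwards [hY.tendsto] with ω hω
  simp only [hc, Finset.sum_sub_distrib, Finset.sum_const, Finset.card_range, nsmul_eq_mul,
    mul_sub] at hω
  have hconst : Tendsto (fun N : ℕ => (N : ℝ)⁻¹ * (N * c)) atTop (𝓝 c) :=
    tendsto_const_nhds.congr' <| (eventually_gt_atTop 0).mono fun N hN =>
      (inv_mul_cancel_left₀ (Nat.cast_ne_zero.2 hN.ne') c).symm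
  simpa using hω.add hconst

variable [IsProbabilityMeasure μ]

theorem IsInnovation.satisfiesLLN_mul (hG : IsInnovation μ F G) {q h : ℕ → Ω → ℝ}
    (hq : ∀ n, Measurable[F n] (q n)) (hqb : UniformlyBounded μ q)
    (hh : BoundedCentered μ G h) : SatisfiesLLN μ fun n ω => q n ω * h n ω where
  integrable n := ((hG.memLp_top hh n).mul (r := ⊤) (hqb.memLp_top
    ((hq n).mono (F.le n) le_rfl).aestronglyMeasurable)).integrable le_top
  tendsto := by
    obtain ⟨R, -, hR⟩ := hqb.exists_ae_forall_norm_le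
    have hmean (n : ℕ) : ∫ ω, q n ω * h n ω ∂μ = 0 :=
      integral_mul_eq_zero_of_indep (hG.indep n) (hG.le n) (F.le n) (hh.measurable n) (hq n)
        (hh.mean_zero n)
    filter_upwards [hG.tendsto_martingaleTransform_div_energy hq hh, hR] with ω hω hqω
    have henergy (N : ℕ) (hN : 1 ≤ N) : energy (fun n => q n ω) N * (N : ℝ)⁻¹ ≤ 2 + R ^ 2 := by
      have hN' : (1 : ℝ) ≤ N := by exact_mod_cast hN
      have hsq : ∑ n ∈ Finset.range N, q n ω ^ 2 ≤ N * R ^ 2 := by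
        simpa using Finset.sum_le_sum fun n (_ : n ∈ Finset.range N) =>
          sq_le_sq.2 ((hqω n).trans (le_abs_self R))
      rw [← div_eq_mul_inv, div_le_iff₀ (by linarith), energy]
      linarith
    have hbdd : IsBoundedUnder (· ≤ ·) atTop
        (norm ∘ fun N : ℕ => energy (fun n => q n ω) N * (N : ℝ)⁻¹) :=
      isBoundedUnder_of_eventually_le <| (eventually_ge_atTop 1).mono fun N hN => by
        have := (energy_pos (fun n => q n ω) N).le
        rw [Function.comp_apply, Real.norm_of_nonneg (by positivity)]
        exact henergy N hN
    refine (hω.zero_mul_isBoundedUnder_le hbdd).congr fun N => ?_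
    have := (energy_pos (fun n => q n ω) N).ne'
    simp only [hmean, sub_zero, martingaleTransform]
    field_simp

theorem IsInnovation.satisfiesLLN (hG : IsInnovation μ F G) {r : ℕ → Ω → ℝ}
    (hr : ∀ n, Measurable[G n] (r n)) (hrb : UniformlyBounded μ r) : SatisfiesLLN μ r := by
  have hint (n : ℕ) : Integrable (r n) μ :=
    hrb.integrable ((hr n).mono (hG.le n) le_rfl).aestronglyMeasurable
  have hcentered : BoundedCentered μ G fun n ω => r n ω - ∫ ω', r n ω' ∂μ :=
    { measurable := fun n => (hr n).sub_const _
      bounded := by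
        obtain ⟨R', hR'⟩ := hrb.exists_norm_integral_le
        obtain ⟨R, hR⟩ := hrb
        exact ⟨R + R', fun n => (hR n).mono fun ω hω =>
          (norm_sub_le _ _).trans (add_le_add hω (hR' n))⟩
      mean_zero := fun n => by rw [integral_sub (hint n) (integrable_const _)]; simp }
  have hlln := hG.satisfiesLLN_mul (q := fun _ _ => 1) (fun _ => measurable_const)
    ⟨1, fun _ => by simp⟩ hcentered
  refine ⟨hint, ?_⟩
  filter_upwards [hlln.tendsto_average (c := 0) fun n => by simpa using hcentered.mean_zero n]
    with ω hω
  simpa only [one_mul] using hω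

theorem UniformlyBounded.satisfiesLLN_sub_succ {V : ℕ → Ω → ℝ} (hVb : UniformlyBounded μ V)
    (hV : ∀ n, Measurable (V n)) : SatisfiesLLN μ fun n ω => V n ω - V (n + 1) ω where
  integrable n := (hVb.integrable (hV n).aestronglyMeasurable).sub
    (hVb.integrable (hV (n + 1)).aestronglyMeasurable)
  tendsto := by
    have hint (n : ℕ) : Integrable (V n) μ := hVb.integrable (hV n).aestronglyMeasurable
    obtain ⟨R, -, hR⟩ := hVb.exists_ae_forall_norm_le
    obtain ⟨R', hR'⟩ := hVb.exists_norm_integral_le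
    filter_upwards [hR] with ω hω
    have hdev (n : ℕ) : |V n ω - ∫ ω', V n ω' ∂μ| ≤ R + R' :=
      (norm_sub_le _ _).trans (add_le_add (hω n) (hR' n))
    refine (tendsto_inv_mul_of_abs_le fun N =>
      (abs_sub _ _).trans (add_le_add (hdev 0) (hdev N))).congr fun N => ?_
    rw [← Finset.sum_range_sub' (fun n => V n ω - ∫ ω', V n ω' ∂μ) N]
    congr 1
    refine Finset.sum_congr rfl fun n _ => ?_
    rw [integral_sub (hint n) (hint (n + 1))]
    ring

end LawOfLargeNumbers

section PowerSummable

theorem summable_norm_pow_of_forall_mem_spectrum {A : Type*} [NormedRing A] [NormedAlgebra ℂ A]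
    [CompleteSpace A] {a : A} (h : ∀ l ∈ spectrum ℂ a, ‖l‖ < 1) : Summable fun k => ‖a ^ k‖ := by
  nontriviality A
  have hradius : spectralRadius ℂ a < (1 : NNReal) :=
    spectrum.spectralRadius_lt_of_forall_lt a fun l hl => h l hl
  obtain ⟨r, har, hr⟩ := ENNReal.lt_iff_exists_nnreal_btwn.1 hradius
  refine Summable.of_norm_bounded_eventually_nat
    (summable_geometric_of_lt_one r.2 (by exact_mod_cast hr)) ?_
  have hroot := spectrum.pow_nnnorm_pow_one_div_tendsto_nhds_spectralRadius a
  filter_upwards [hroot.eventually_lt_const har, eventually_ge_atTop 1] with n hn hn1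
  have hpow := ENNReal.rpow_le_rpow hn.le (Nat.cast_nonneg (α := ℝ) n)
  rw [← ENNReal.rpow_mul, one_div, inv_mul_cancel₀ (by positivity), ENNReal.rpow_one,
    ENNReal.rpow_natCast] at hpow
  rw [norm_norm]
  exact_mod_cast hpow

variable {ι κ : Type*} [Fintype ι] [DecidableEq ι] [Fintype κ]

theorem summable_norm_pow_of_forall_mem_spectrum_map {M : Matrix ι ι ℝ}
    (h : ∀ l ∈ spectrum ℂ (M.map (algebraMap ℝ ℂ)), ‖l‖ < 1) : Summable fun k => ‖M ^ k‖ := by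
  have hre : Continuous (Complex.reLm.mapMatrix : Matrix ι ι ℂ →ₗ[ℝ] Matrix ι ι ℝ) :=
    LinearMap.continuous_of_finiteDimensional _
  refine ((summable_norm_pow_of_forall_mem_spectrum h).of_norm.map _ hre).norm.congr fun k => ?_
  congr 1
  ext i j
  rw [Function.comp_apply, ← Matrix.map_pow]
  simp

theorem SchurStable.summable {d : ℕ} {M : Matrix (Fin d) (Fin d) ℝ} (h : SchurStable M) :
    Summable fun k => ‖M ^ k‖ :=
  summable_norm_pow_of_forall_mem_spectrum_map h

theorem SchurStable.summable_fromBlocks {d d' : ℕ} {M : Matrix (Fin d) (Fin d) ℝ}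
    {D : Matrix (Fin d') (Fin d') ℝ} (hM : SchurStable M) (hD : SchurStable D)
    (B : Matrix (Fin d) (Fin d') ℝ) : Summable fun k => ‖fromBlocks M B 0 D ^ k‖ := by
  refine summable_norm_pow_of_forall_mem_spectrum_map fun l hl => ?_
  rw [fromBlocks_map, Matrix.map_zero _ (map_zero _), mem_spectrum_iff_isRoot_charpoly,
    charpoly_fromBlocks_zero₂₁, Polynomial.IsRoot.def, Polynomial.eval_mul, mul_eq_zero] at hl
  rcases hl with hl | hl
  · exact hM l (mem_spectrum_iff_isRoot_charpoly.2 hl)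
  · exact hD l (mem_spectrum_iff_isRoot_charpoly.2 hl)

theorem norm_apply_le_l2_opNorm {𝕜 : Type*} [RCLike 𝕜] (M : Matrix κ ι 𝕜) (i : κ) (j : ι) :
    ‖M i j‖ ≤ ‖M‖ := by
  have hcol := (PiLp.norm_apply_le _ i).trans (l2_opNorm_mulVec M (EuclideanSpace.single j 1))
  simpa using hcol

theorem norm_mulVec_le (M : Matrix κ ι ℝ) (v : ι → ℝ) :
    ‖M *ᵥ v‖ ≤ ‖M‖ * (Fintype.card ι * ‖v‖) := by
  refine (pi_norm_le_iff_of_nonneg (by positivity)).2 fun i => ?_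
  calc ‖∑ j, M i j * v j‖ ≤ ∑ _j : ι, ‖M‖ * ‖v‖ := norm_sum_le_of_le _ fun j _ => by
        rw [norm_mul]
        exact mul_le_mul (norm_apply_le_l2_opNorm M i j) (norm_le_pi_norm v j) (norm_nonneg _)
          (norm_nonneg _)
    _ = ‖M‖ * (Fintype.card ι * ‖v‖) := by simp; ring

theorem exists_lyapunov {M : Matrix ι ι ℝ} (h : Summable fun k => ‖M ^ k‖) (Q : Matrix ι ι ℝ) :
    ∃ P : Matrix ι ι ℝ, P = Q + Mᵀ * P * M := by
  have htranspose (k : ℕ) : ‖Mᵀ ^ k‖ = ‖M ^ k‖ := by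
    rw [← Matrix.transpose_pow, ← conjTranspose_eq_transpose_of_trivial, l2_opNorm_conjTranspose]
  obtain ⟨c, hc⟩ := h.tendsto_atTop_zero.bddAbove_range
  have hs : Summable fun k => Mᵀ ^ k * Q * M ^ k := by
    refine Summable.of_norm_bounded (h.mul_left (c * ‖Q‖)) fun k => ?_
    calc ‖Mᵀ ^ k * Q * M ^ k‖ ≤ ‖Mᵀ ^ k‖ * ‖Q‖ * ‖M ^ k‖ :=
          (l2_opNorm_mul _ _).trans (by gcongr; exact l2_opNorm_mul _ _)
      _ ≤ c * ‖Q‖ * ‖M ^ k‖ := by rw [htranspose]; gcongr; exact hc ⟨k, rfl⟩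
  refine ⟨∑' k, Mᵀ ^ k * Q * M ^ k, ?_⟩
  rw [← hs.tsum_mul_left, ← (hs.mul_left _).tsum_mul_right, hs.tsum_eq_zero_add]
  simp only [pow_zero, one_mul, mul_one, pow_succ' Mᵀ, pow_succ M, Matrix.mul_assoc]

end PowerSummable

section LinearRecursion

variable {ι κ : Type*} [Fintype ι] [DecidableEq ι] [Fintype κ] {M : Matrix ι ι ℝ}

theorem linear_recursion {R : Type*} [Semiring R] {M : Matrix ι ι R} {s b : ℕ → ι → R}
    (hs : ∀ n, s (n + 1) = M *ᵥ s n + b n) (n : ℕ) :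
    s n = M ^ n *ᵥ s 0 + ∑ k ∈ Finset.range n, M ^ (n - 1 - k) *ᵥ b k := by
  induction n with
  | zero => simp
  | succ n ih =>
    rw [hs, ih, mulVec_add, mulVec_mulVec, ← pow_succ', Finset.sum_range_succ, add_assoc,
      Matrix.mulVec_sum]
    congr 2
    · refine Finset.sum_congr rfl fun k hk => ?_
      rw [mulVec_mulVec, ← pow_succ']
      congr 2
      have := Finset.mem_range.1 hk
      omega
    · simp

theorem norm_linear_recursion_le (h : Summable fun k => ‖M ^ k‖) {s b : ℕ → ι → ℝ}
    (hs0 : s 0 = 0) (hs : ∀ n, s (n + 1) = M *ᵥ s n + b n) {R : ℝ} (hb : ∀ n, ‖b n‖ ≤ R) (n : ℕ) :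
    ‖s n‖ ≤ (∑' k, ‖M ^ k‖) * (Fintype.card ι * R) := by
  have hR : 0 ≤ R := (norm_nonneg _).trans (hb 0)
  rw [linear_recursion hs n, hs0, mulVec_zero, zero_add]
  calc ‖∑ k ∈ Finset.range n, M ^ (n - 1 - k) *ᵥ b k‖
      ≤ ∑ k ∈ Finset.range n, ‖M ^ (n - 1 - k)‖ * (Fintype.card ι * R) :=
        norm_sum_le_of_le _ fun k _ => (norm_mulVec_le _ _).trans (by gcongr; exact hb k)
    _ = (∑ k ∈ Finset.range n, ‖M ^ k‖) * (Fintype.card ι * R) := by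
        rw [← Finset.sum_mul, Finset.sum_range_reflect (fun k => ‖M ^ k‖) n]
    _ ≤ (∑' k, ‖M ^ k‖) * (Fintype.card ι * R) := by
        gcongr
        exact h.sum_le_tsum _ fun _ _ => norm_nonneg _

theorem UniformlyBounded.linear_recursion {Ω : Type*} [MeasurableSpace Ω] {μ : Measure Ω}
    (h : Summable fun k => ‖M ^ k‖) {s b : ℕ → Ω → ι → ℝ} (hb : UniformlyBounded μ b)
    (hs0 : ∀ ω, s 0 ω = 0) (hs : ∀ n ω, s (n + 1) ω = M *ᵥ s n ω + b n ω) :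
    UniformlyBounded μ s := by
  obtain ⟨R, -, hR⟩ := hb.exists_ae_forall_norm_le
  exact ⟨_, fun n => hR.mono fun ω hω =>
    norm_linear_recursion_le h (s := fun n => s n ω) (hs0 ω) (hs · ω) hω n⟩

theorem tendsto_pow_mulVec (h : Summable fun k => ‖M ^ k‖) (v : ι → ℝ) :
    Tendsto (fun n => M ^ n *ᵥ v) atTop (𝓝 0) := by
  have hpow : Tendsto (fun n => M ^ n) atTop (𝓝 0) := h.of_norm.tendsto_atTop_zero
  have hmulVec : Continuous fun N : Matrix ι ι ℝ => N *ᵥ v :=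
    continuous_id.matrix_mulVec continuous_const
  have hzero := (hmulVec.tendsto 0).comp hpow
  rwa [zero_mulVec] at hzero

end LinearRecursion

section QuadraticLaw

variable {Ω : Type*} {mΩ : MeasurableSpace Ω} {μ : Measure Ω} {ι κ : Type*} [Fintype ι] [Fintype κ]

omit [Fintype κ] in
theorem measurable_mulVec (M : Matrix κ ι ℝ) : Measurable fun v : ι → ℝ => M *ᵥ v :=
  measurable_pi_lambda _ fun _ => (continuous_const.dotProduct continuous_id).measurable

theorem lyapunov_dissipation {M P : Matrix ι ι ℝ} {D : Matrix κ ι ℝ} (hP : P = Dᵀ * D + Mᵀ * P * M)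
    (s b : ι → ℝ) (g : κ → ℝ) :
    (D *ᵥ s + g) ⬝ᵥ (D *ᵥ s + g)
      = s ⬝ᵥ P *ᵥ s - (M *ᵥ s + b) ⬝ᵥ P *ᵥ (M *ᵥ s + b)
        + s ⬝ᵥ ((Mᵀ * (P + Pᵀ)) *ᵥ b + (2 • Dᵀ) *ᵥ g) + (b ⬝ᵥ P *ᵥ b + g ⬝ᵥ g) := by
  have hstate : s ⬝ᵥ P *ᵥ s = (D *ᵥ s) ⬝ᵥ (D *ᵥ s) + (M *ᵥ s) ⬝ᵥ P *ᵥ (M *ᵥ s) := by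
    conv_lhs => rw [hP]
    rw [add_mulVec, dotProduct_add]
    simp only [← mulVec_mulVec]
    rw [dotProduct_mulVec s Dᵀ, dotProduct_mulVec s Mᵀ, vecMul_transpose, vecMul_transpose]
  have hdrive : s ⬝ᵥ ((Mᵀ * (P + Pᵀ)) *ᵥ b) = (M *ᵥ s) ⬝ᵥ P *ᵥ b + b ⬝ᵥ P *ᵥ (M *ᵥ s) := by
    rw [← mulVec_mulVec, dotProduct_mulVec s Mᵀ, vecMul_transpose, add_mulVec, dotProduct_add,
      dotProduct_mulVec _ Pᵀ, vecMul_transpose, dotProduct_comm _ b]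
  have hnoise : s ⬝ᵥ ((2 • Dᵀ) *ᵥ g) = 2 * ((D *ᵥ s) ⬝ᵥ g) := by
    rw [smul_mulVec, dotProduct_smul, dotProduct_mulVec, vecMul_transpose, nsmul_eq_mul,
      Nat.cast_ofNat]
  rw [dotProduct_add s, hstate, hdrive, hnoise]
  simp only [mulVec_add, dotProduct_add, add_dotProduct]
  rw [dotProduct_comm g (D *ᵥ s)]
  ring

variable {F : Filtration ℕ mΩ} {G : ℕ → MeasurableSpace Ω}

theorem IsInnovation.measurable_linear_recursion (hG : IsInnovation μ F G) {M : Matrix ι ι ℝ}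
    {s b : ℕ → Ω → ι → ℝ} (hb : ∀ n, Measurable[G n] (b n)) (hs0 : ∀ ω, s 0 ω = 0)
    (hs : ∀ n ω, s (n + 1) ω = M *ᵥ s n ω + b n ω) (n : ℕ) : Measurable[F n] (s n) := by
  induction n with
  | zero => rw [funext hs0]; exact measurable_const
  | succ n ih =>
    rw [funext (hs n)]
    exact ((measurable_mulVec M).comp (ih.mono (F.mono n.le_succ) le_rfl)).add
      ((hb n).mono (hG.le_succ n) le_rfl)

/-- The Lyapunov function telescopes, the first order terms form a martingale difference sequence,
and the remaining terms depend on a single innovation each. -/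
theorem IsInnovation.satisfiesLLN_dotProduct_output_self [IsProbabilityMeasure μ] [DecidableEq ι]
    (hG : IsInnovation μ F G) {M : Matrix ι ι ℝ} (hM : Summable fun k => ‖M ^ k‖)
    (D : Matrix κ ι ℝ) {b : ℕ → Ω → ι → ℝ} {g : ℕ → Ω → κ → ℝ} (hb : BoundedCentered μ G b)
    (hg : BoundedCentered μ G g) {s : ℕ → Ω → ι → ℝ} (hs0 : ∀ ω, s 0 ω = 0)
    (hs : ∀ n ω, s (n + 1) ω = M *ᵥ s n ω + b n ω) :
    SatisfiesLLN μ fun n ω => (D *ᵥ s n ω + g n ω) ⬝ᵥ (D *ᵥ s n ω + g n ω) := by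
  obtain ⟨P, hP⟩ := exists_lyapunov hM (Dᵀ * D)
  have hsF := hG.measurable_linear_recursion hb.measurable hs0 hs
  have hsb : UniformlyBounded μ s := hb.bounded.linear_recursion hM hs0 hs
  have hV : Continuous fun v : ι → ℝ => v ⬝ᵥ P *ᵥ v :=
    continuous_id.dotProduct (continuous_const.matrix_mulVec continuous_id)
  have hV_lln : SatisfiesLLN μ fun n ω =>
      s n ω ⬝ᵥ P *ᵥ s n ω - s (n + 1) ω ⬝ᵥ P *ᵥ s (n + 1) ω :=
    (hsb.continuous_comp hV).satisfiesLLN_sub_succ fun n =>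
      hV.measurable.comp ((hsF n).mono (F.le n) le_rfl)
  have hfirst : BoundedCentered μ G fun n ω =>
      (Mᵀ * (P + Pᵀ)) *ᵥ b n ω + (2 • Dᵀ) *ᵥ g n ω :=
    (hb.prodMk hg hG.le).linearMap_comp hG.le
      ((mulVecLin (Mᵀ * (P + Pᵀ))).coprod (mulVecLin (2 • Dᵀ)))
  have hfirst_lln : SatisfiesLLN μ fun n ω =>
      s n ω ⬝ᵥ ((Mᵀ * (P + Pᵀ)) *ᵥ b n ω + (2 • Dᵀ) *ᵥ g n ω) :=
    SatisfiesLLN.sum Finset.univ fun i _ => hG.satisfiesLLN_mul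
      (fun n => (measurable_pi_apply i).comp (hsF n)) (hsb.continuous_comp (continuous_apply i))
      (hfirst.linearMap_comp hG.le (LinearMap.proj i))
  have hsecond : Continuous fun v : (ι → ℝ) × (κ → ℝ) => v.1 ⬝ᵥ P *ᵥ v.1 + v.2 ⬝ᵥ v.2 :=
    (hV.comp continuous_fst).add (continuous_snd.dotProduct continuous_snd)
  have hsecond_lln : SatisfiesLLN μ fun n ω => b n ω ⬝ᵥ P *ᵥ b n ω + g n ω ⬝ᵥ g n ω :=
    hG.satisfiesLLN (fun n => hsecond.measurable.comp ((hb.measurable n).prodMk (hg.measurable n)))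
      ((hb.bounded.prodMk hg.bounded).continuous_comp hsecond)
  convert (hV_lln.add hfirst_lln).add hsecond_lln using 3 with n ω
  rw [lyapunov_dissipation hP _ (b n ω), hs]

end QuadraticLaw

section OpNorm

variable {ι κ : Type*} [Fintype ι] [Fintype κ] [DecidableEq κ]

theorem abs_trace_le_l2_opNorm (M : Matrix κ κ ℝ) : |M.trace| ≤ Fintype.card κ * ‖M‖ :=
  (Finset.abs_sum_le_sum_abs _ _).trans <|
    (Finset.sum_le_card_nsmul _ _ _ fun i _ => norm_apply_le_l2_opNorm M i i).trans_eq (by simp)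

theorem measurable_l2_opNorm {Ω : Type*} {_ : MeasurableSpace Ω} {M : Ω → Matrix ι κ ℝ}
    (h : ∀ i j, Measurable fun ω => M ω i j) : Measurable fun ω => ‖M ω‖ := by
  have hc : Continuous fun f : ι → κ → ℝ => ‖(Matrix.of f : Matrix ι κ ℝ)‖ :=
    continuous_norm.comp continuous_id
  exact hc.measurable.comp (measurable_pi_lambda _ fun i => measurable_pi_lambda _ (h i))

omit [Fintype ι] [DecidableEq κ] in
theorem measurable_mulVec_of_apply {Ω : Type*} {_ : MeasurableSpace Ω} {M : Ω → Matrix ι κ ℝ}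
    {v : Ω → κ → ℝ} (hM : ∀ i j, Measurable fun ω => M ω i j) (hv : Measurable v) :
    Measurable fun ω => M ω *ᵥ v ω :=
  measurable_pi_lambda _ fun i =>
    Finset.measurable_fun_sum _ fun j _ => (hM i j).mul ((measurable_pi_apply j).comp hv)

end OpNorm

theorem tendsto_threshold (ρ S : ℝ) : Tendsto (threshold ρ S) atTop (𝓝 0) := by
  have hlog : Tendsto (fun N : ℕ => Real.log N / N) atTop (𝓝 0) :=
    Real.isLittleO_log_id_atTop.tendsto_div_nhds_zero.comp tendsto_natCast_atTop_atTop
  have hsqrt := (hlog.const_mul ((1 + ρ) * S)).sqrt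
  rw [mul_zero, Real.sqrt_zero] at hsqrt
  exact hsqrt.congr fun N => by rw [threshold, mul_div_assoc]

variable {Ω : Type*} {p q m : ℕ} {P : Plant p q m} {I : Inputs Ω p q m} {a : Attack Ω p m}
  {s : Signals Ω p m}

section Dynamics

/-- The first nonzero Markov parameter `C₁ (A + B K) ^ k' B`, through which the private excitation
reaches the output with the smallest possible delay. -/
noncomputable def Plant.feedthrough (P : Plant p q m) : Matrix (Fin m) (Fin q) ℝ :=
  P.C₁ * (P.A + P.B * P.K) ^ P.lag * P.B

theorem Plant.feedthrough_ne_zero (h : ∃ k : ℕ, P.C₁ * (P.A + P.B * P.K) ^ k * P.B ≠ 0) :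
    P.feedthrough ≠ 0 :=
  Nat.sInf_mem (s := {k : ℕ | P.C₁ * (P.A + P.B * P.K) ^ k * P.B ≠ 0}) h

theorem Plant.eq_zero_of_lt_lag {k : ℕ} (h : k < P.lag) :
    P.C₁ * (P.A + P.B * P.K) ^ k * P.B = 0 :=
  not_not.1 (Nat.notMem_of_lt_sInf h)

/-- The estimation error `x̂ - x` of the never switching observer. -/
def estimationError (s : Signals Ω p m) (n : ℕ) (ω : Ω) : Fin p → ℝ := s.xh n ω - s.x n ω

theorem residual_eq (n : ℕ) (ω : Ω) :
    residual P I s n ω = P.C₁ *ᵥ estimationError s n ω - I.z n ω - s.v n ω := by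
  simp only [residual, measurement, estimationError, mulVec_sub]
  abel

theorem ClosedLoop.estimationError_zero (h : ClosedLoop P I a s) (ω : Ω) :
    estimationError s 0 ω = 0 := by
  simp [estimationError, h.fixed_observer_init]

theorem ClosedLoop.estimationError_succ (h : ClosedLoop P I a s) (n : ℕ) (ω : Ω) :
    estimationError s (n + 1) ω = (P.A + P.L₁ * P.C₁) *ᵥ estimationError s n ω
      - I.w n ω - P.L₁ *ᵥ (I.z n ω + s.v n ω) := by
  have hfeedback : estimationError s (n + 1) ω
      = P.A *ᵥ estimationError s n ω - I.w n ω + P.L₁ *ᵥ residual P I s n ω := by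
    simp only [estimationError, h.fixed_observer, h.state, mulVec_sub]
    abel
  rw [hfeedback, residual_eq]
  simp only [add_mulVec, mulVec_sub, mulVec_add, ← mulVec_mulVec]
  abel

theorem ClosedLoop.x_succ (h : ClosedLoop P I a s) (n : ℕ) (ω : Ω) :
    s.x (n + 1) ω = (P.A + P.B * P.K) *ᵥ s.x n ω
      + (P.B *ᵥ (P.K *ᵥ (s.x' n ω - s.x n ω) + I.e n ω) + I.w n ω) := by
  rw [h.state]
  simp only [add_mulVec, mulVec_sub, mulVec_add, ← mulVec_mulVec]
  abel

theorem ClosedLoop.output_add (h : ClosedLoop P I a s) {i : ℕ} (hi : i ≤ P.lag) (n : ℕ) (ω : Ω) :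
    P.C₁ *ᵥ s.x (n + i) ω = (P.C₁ * (P.A + P.B * P.K) ^ i) *ᵥ s.x n ω
      + ∑ k ∈ Finset.range i, (P.C₁ * (P.A + P.B * P.K) ^ (i - 1 - k)) *ᵥ I.w (n + k) ω := by
  rw [linear_recursion (s := fun k => s.x (n + k) ω) (fun k => h.x_succ (n + k) ω) i, mulVec_add,
    mulVec_mulVec, mulVec_sum]
  congr 1
  refine Finset.sum_congr rfl fun k hk => ?_
  have hki := Finset.mem_range.1 hk
  rw [mulVec_mulVec, mulVec_add, mulVec_mulVec, Plant.eq_zero_of_lt_lag (by omega), zero_mulVec,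
    zero_add]

theorem ClosedLoop.output_add_lag_succ (h : ClosedLoop P I a s) (n : ℕ) (ω : Ω) :
    P.C₁ *ᵥ s.x (n + (P.lag + 1)) ω
      = P.feedthrough *ᵥ I.e n ω
        + ((P.C₁ * (P.A + P.B * P.K) ^ (P.lag + 1)) *ᵥ s.x n ω
          + (P.C₁ * (P.A + P.B * P.K) ^ P.lag) *ᵥ
              (P.B *ᵥ (P.K *ᵥ (s.x' n ω - s.x n ω)) + I.w n ω)
          + ∑ k ∈ Finset.range P.lag,
              (P.C₁ * (P.A + P.B * P.K) ^ (P.lag - 1 - k)) *ᵥ I.w (n + 1 + k) ω) := by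
  rw [Plant.feedthrough, show n + (P.lag + 1) = n + 1 + P.lag by ring, h.output_add le_rfl,
    h.x_succ, pow_succ, ← Matrix.mul_assoc]
  simp only [mulVec_add, mulVec_mulVec, Matrix.mul_assoc]
  abel

theorem Phi₂_apply (ω : Ω) (J : ℕ) (i : Fin m) (k : Fin q) :
    Phi₂ P I s (J + (P.lag + 1)) ω i k = ((J + (P.lag + 1) : ℕ) : ℝ)⁻¹ *
      ∑ j ∈ Finset.range J, residual P I s (j + (P.lag + 1)) ω i * I.e j ω k := by
  have hearly : ∑ n ∈ Finset.range (P.lag + 1),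
      residual P I s n ω i * delayedExcitation P I n ω k = 0 :=
    Finset.sum_eq_zero fun n hn => by
      have := Finset.mem_range.1 hn
      rw [delayedExcitation, if_neg (by omega), Pi.zero_apply, mul_zero]
  simp only [Phi₂, Matrix.smul_apply, Matrix.sum_apply, vecMulVec_apply, smul_eq_mul, one_div]
  rw [add_comm J, Finset.sum_range_add, hearly, zero_add]
  congr 1
  refine Finset.sum_congr rfl fun j _ => ?_
  rw [delayedExcitation, if_pos (by omega), add_comm (P.lag + 1) j, Nat.add_sub_cancel]

end Dynamics

section Measurability

/-- Initial conditions and all random inputs other than the private excitation. -/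
def exogenous (I : Inputs Ω p q m) (a : Attack Ω p m) (s : Signals Ω p m) (ω : Ω) :
    ((Fin p → ℝ) × (Fin p → ℝ) × (Fin p → ℝ)) ×
      (ℕ → (Fin p → ℝ) × (Fin m → ℝ) × (Fin m → ℝ) × (Fin p → ℝ) × (Fin m → ℝ)) :=
  ((s.x 0 ω, s.x' 0 ω, s.ξ 0 ω), fun n => (I.w n ω, I.z n ω, I.η n ω, a.d n ω, a.ζ n ω))

/-- The signals at time `n`, other than those of the attacker, are measurable with respect to `𝓖`,
which need not be the ambient σ-algebra. -/
structure Signals.MeasurableAt (s : Signals Ω p m) (𝓖 : MeasurableSpace Ω) (n : ℕ) : Prop where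
  x : Measurable (s.x n)
  x' : Measurable (s.x' n)
  xh : Measurable (s.xh n)
  α : Measurable (s.α n)

variable {𝓖 : MeasurableSpace Ω}

theorem measurable_inputs (h : Measurable (exogenous I a s)) (n : ℕ) :
    Measurable (I.w n) ∧ Measurable (I.z n) ∧ Measurable (I.η n)
      ∧ Measurable (a.d n) ∧ Measurable (a.ζ n) := by
  have hn : Measurable fun ω => (I.w n ω, I.z n ω, I.η n ω, a.d n ω, a.ζ n ω) :=
    (measurable_pi_apply n).comp h.snd
  exact ⟨hn.fst, hn.snd.fst, hn.snd.snd.fst, hn.snd.snd.snd.fst, hn.snd.snd.snd.snd⟩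

theorem measurable_ξ (hloop : ClosedLoop P I a s) (h : Measurable (exogenous I a s)) (n : ℕ) :
    Measurable (s.ξ n) := by
  induction n with
  | zero => exact h.fst.snd.snd
  | succ n ih =>
    rw [funext (hloop.replay n)]
    exact ((measurable_mulVec _).comp ih).add (measurable_inputs h n).2.2.2.1

theorem measurable_v (hloop : ClosedLoop P I a s) (h : Measurable (exogenous I a s)) {n : ℕ}
    (hx : Measurable fun ω => P.C₁ *ᵥ s.x n ω) : Measurable (s.v n) := by
  obtain ⟨-, hz, -, -, hζ⟩ := measurable_inputs h n
  rw [funext (hloop.attack n)]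
  exact (((measurable_mulVec _).comp (measurable_ξ hloop h n)).add hζ).sub
    ((hx.add hz).const_smul a.γ)

theorem measurable_residual (hloop : ClosedLoop P I a s) (h : Measurable (exogenous I a s))
    {n : ℕ} (hn : s.MeasurableAt 𝓖 n) : Measurable (residual P I s n) :=
  have hx := (measurable_mulVec P.C₁).comp hn.x
  ((measurable_mulVec _).comp hn.xh).sub
    ((hx.add (measurable_inputs h n).2.1).add (measurable_v hloop h hx))

theorem measurable_norm_Phi₁ {mΩ : MeasurableSpace Ω} (μ : Measure[mΩ] Ω) {N : ℕ}
    (h : ∀ n < N, Measurable[𝓖] (residual P I s n)) :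
    Measurable[𝓖] fun ω => ‖Phi₁ μ P I s N ω‖ := by
  refine measurable_l2_opNorm fun i j => ?_
  simp only [Phi₁, Matrix.sub_apply, Matrix.smul_apply, Matrix.sum_apply, vecMulVec_apply,
    smul_eq_mul]
  refine ((Finset.measurable_fun_sum _ fun n hn => ?_).const_mul _).sub measurable_const
  have hn' := h n (Finset.mem_range.1 hn)
  exact ((measurable_pi_apply i).comp hn').mul ((measurable_pi_apply j).comp hn')

theorem measurable_norm_Phi₂ {N : ℕ} (h : ∀ n < N, Measurable (residual P I s n))
    (he : ∀ n < N, Measurable (I.e n)) : Measurable fun ω => ‖Phi₂ P I s N ω‖ := by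
  refine measurable_l2_opNorm fun i j => ?_
  simp only [Phi₂, Matrix.smul_apply, Matrix.sum_apply, vecMulVec_apply, smul_eq_mul]
  refine (Finset.measurable_fun_sum _ fun n hn => ?_).const_mul _
  have hnN := Finset.mem_range.1 hn
  have hdelayed : Measurable (delayedExcitation P I n) := by
    unfold delayedExcitation
    split_ifs
    · exact he _ (by omega)
    · exact measurable_const
  exact ((measurable_pi_apply i).comp (h n hnN)).mul ((measurable_pi_apply j).comp hdelayed)

open Classical in
theorem SwitchingRule.α_succ {mΩ : MeasurableSpace Ω} {μ : Measure Ω} {ρ S : ℝ} {τ : ℕ}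
    (h : SwitchingRule μ P I s ρ S τ) (n : ℕ) (ω : Ω) : s.α (n + 1) ω =
      if threshold ρ S (n + 1) ≤ ‖Phi₁ μ P I s (n + 1) ω‖ ∨
          threshold ρ S (n + 1) ≤ ‖Phi₂ P I s (n + 1) ω‖ then 0
      else if s.α n ω = 0 ∧ τ ≤ n + 1 ∧ ∀ i ∈ Finset.Icc 1 τ, s.α (n + 1 - i) ω = 0 then 1
      else s.α n ω := by
  split_ifs with hviolated hreturn
  · exact h.violated _ _ n.succ_pos hviolated
  · push Not at hviolated
    exact h.return_ _ _ n.succ_pos hviolated.1 hviolated.2 hreturn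
  · push Not at hviolated
    exact h.keep _ _ n.succ_pos hviolated.1 hviolated.2 hreturn

theorem SwitchingRule.measurable_α_succ {mΩ : MeasurableSpace Ω} {μ : Measure[mΩ] Ω} {ρ S : ℝ}
    {τ : ℕ} (h : SwitchingRule μ P I s ρ S τ) {n : ℕ}
    (hα : ∀ k ≤ n, Measurable[𝓖] (s.α k)) (hres : ∀ k ≤ n, Measurable[𝓖] (residual P I s k))
    (he : ∀ k ≤ n, Measurable[𝓖] (I.e k)) : Measurable[𝓖] (s.α (n + 1)) := by
  classical
  have hzero (k : ℕ) (hk : k ≤ n) : MeasurableSet[𝓖] {ω | s.α k ω = 0} :=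
    hα k hk (measurableSet_singleton 0)
  have hrun : MeasurableSet[𝓖] {ω | ∀ i ∈ Finset.Icc 1 τ, s.α (n + 1 - i) ω = 0} := by
    simp only [Set.ofPred_forall]
    exact Finset.measurableSet_biInter _ fun i hi => hzero _ (by
      have := (Finset.mem_Icc.1 hi).1
      omega)
  rw [funext (h.α_succ n)]
  refine Measurable.ite (MeasurableSet.union ?_ ?_) measurable_const <|
    Measurable.ite ((hzero n le_rfl).inter ((MeasurableSet.const _).inter hrun)) measurable_const
      (hα n le_rfl)
  · exact measurableSet_le measurable_const
      (measurable_norm_Phi₁ μ fun k hk => hres k (Nat.lt_succ_iff.1 hk))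
  · exact measurableSet_le measurable_const
      (measurable_norm_Phi₂ (fun k hk => hres k (Nat.lt_succ_iff.1 hk))
        fun k hk => he k (Nat.lt_succ_iff.1 hk))

theorem measurable_smul_add_one_sub_smul {ι κ : Type*} {α : Ω → ℝ} (hα : Measurable α)
    (M N : Matrix ι κ ℝ) (i : ι) (j : κ) :
    Measurable fun ω => (α ω • M + (1 - α ω) • N) i j :=
  (hα.mul_const (M i j)).add ((hα.const_sub 1).mul_const (N i j))

theorem measurable_x'_succ (hloop : ClosedLoop P I a s) (h : Measurable (exogenous I a s)) {n : ℕ}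
    (hs : s.MeasurableAt 𝓖 n) (he : Measurable (I.e n)) : Measurable (s.x' (n + 1)) := by
  obtain ⟨-, hz, hη, -, -⟩ := measurable_inputs h n
  have hv := measurable_v hloop h ((measurable_mulVec P.C₁).comp hs.x)
  have hC := measurable_smul_add_one_sub_smul hs.α P.C₁ P.C₂
  have hL := measurable_smul_add_one_sub_smul hs.α P.L₁ P.L₂
  rw [funext (hloop.switching_observer n)]
  refine (((measurable_mulVec _).comp hs.x').add
    ((measurable_mulVec _).comp (((measurable_mulVec _).comp hs.x').add he))).add
    (measurable_mulVec_of_apply hL ?_)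
  exact (measurable_mulVec_of_apply hC hs.x').sub
    (((measurable_mulVec_of_apply hC hs.x).add
      ((hs.α.smul hz).add ((hs.α.const_sub 1).smul hη))).add (hs.α.smul hv))

theorem measurableAt {mΩ : MeasurableSpace Ω} {μ : Measure[mΩ] Ω} {ρ S : ℝ} {τ : ℕ}
    (hloop : ClosedLoop P I a s) (hswitch : SwitchingRule μ P I s ρ S τ)
    (h : Measurable[𝓖] (exogenous I a s)) {n : ℕ} (he : ∀ k < n, Measurable[𝓖] (I.e k)) :
    s.MeasurableAt 𝓖 n := by
  induction n using Nat.strong_induction_on with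
  | _ n ih =>
  cases n with
  | zero =>
    exact
    { x := h.fst.fst
      x' := h.fst.snd.fst
      xh := by rw [funext hloop.fixed_observer_init]; exact h.fst.fst
      α := by rw [funext hswitch.init]; exact measurable_const }
  | succ n =>
    have hpast (k : ℕ) (hk : k ≤ n) : s.MeasurableAt 𝓖 k :=
      ih k (by omega) fun l hl => he l (by omega)
    have hn := hpast n le_rfl
    have hres (k : ℕ) (hk : k ≤ n) : Measurable[𝓖] (residual P I s k) :=
      measurable_residual hloop h (hpast k hk)
    have hu : Measurable[𝓖] fun ω => P.B *ᵥ (P.K *ᵥ s.x' n ω + I.e n ω) :=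
      (measurable_mulVec _).comp (((measurable_mulVec _).comp hn.x').add (he n n.lt_succ_self))
    exact
    { x := by
        rw [funext (hloop.state n)]
        exact (((measurable_mulVec _).comp hn.x).add hu).add (measurable_inputs h n).1
      x' := measurable_x'_succ hloop h hn (he n n.lt_succ_self)
      xh := by
        rw [funext (hloop.fixed_observer n)]
        exact (((measurable_mulVec _).comp hn.xh).add hu).add
          ((measurable_mulVec _).comp (hres n le_rfl))
      α := hswitch.measurable_α_succ (fun k hk => (hpast k hk).α) hres
        fun k hk => he k (Nat.lt_succ_iff.2 hk) }

section Feedthrough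

variable {mΩ : MeasurableSpace Ω} {μ : Measure[mΩ] Ω} {ρ S : ℝ} {τ : ℕ}

theorem measurable_output (hloop : ClosedLoop P I a s) (hswitch : SwitchingRule μ P I s ρ S τ)
    {j n : ℕ} (h : Measurable[𝓖] (exogenous I a s)) (he : ∀ k < j, Measurable[𝓖] (I.e k))
    (hn : n ≤ j + P.lag) : Measurable[𝓖] fun ω => P.C₁ *ᵥ s.x n ω := by
  rcases le_total n j with hnj | hjn
  · exact (measurable_mulVec _).comp
      (measurableAt hloop hswitch h fun k hk => he k (hk.trans_le hnj)).x
  · obtain ⟨i, rfl⟩ := Nat.exists_eq_add_of_le hjn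
    simp only [hloop.output_add (Nat.add_le_add_iff_left.1 hn)]
    exact ((measurable_mulVec _).comp (measurableAt hloop hswitch h he).x).add
      (Finset.measurable_fun_sum _ fun k _ => (measurable_mulVec _).comp (measurable_inputs h _).1)

theorem measurable_estimationError (hloop : ClosedLoop P I a s)
    (h : Measurable (exogenous I a s)) {n : ℕ}
    (hx : ∀ k < n, Measurable fun ω => P.C₁ *ᵥ s.x k ω) : Measurable (estimationError s n) := by
  induction n with
  | zero => rw [funext hloop.estimationError_zero]; exact measurable_const
  | succ n ih =>
    obtain ⟨hw, hz, -⟩ := measurable_inputs h n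
    rw [funext (hloop.estimationError_succ n)]
    exact (((measurable_mulVec _).comp (ih fun k hk => hx k (by omega))).sub hw).sub
      ((measurable_mulVec _).comp (hz.add (measurable_v hloop h (hx n n.lt_succ_self))))

/-- `e_j` reaches the output `C₁ x` only after `P.lag + 1` steps, and the estimation error is driven
by outputs of earlier times, so that the remaining part of the residual does not involve `e_j`. -/
theorem measurable_residual_sub_feedthrough (hloop : ClosedLoop P I a s)
    (hswitch : SwitchingRule μ P I s ρ S τ) {j : ℕ} (h : Measurable[𝓖] (exogenous I a s))
    (he : ∀ k < j, Measurable[𝓖] (I.e k)) :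
    Measurable[𝓖] fun ω => residual P I s (j + (P.lag + 1)) ω
      - a.γ • (P.feedthrough *ᵥ I.e j ω) := by
  have hj := measurableAt hloop hswitch h he
  have herror : Measurable[𝓖] (estimationError s (j + (P.lag + 1))) :=
    measurable_estimationError hloop h fun k hk => measurable_output hloop hswitch h he (by omega)
  obtain ⟨-, hz, -, -, hζ⟩ := measurable_inputs h (j + (P.lag + 1))
  have hξ := measurable_ξ hloop h (j + (P.lag + 1))
  simp only [residual_eq, hloop.attack, hloop.output_add_lag_succ]
  set rest : Ω → Fin m → ℝ := fun ω =>
    (P.C₁ * (P.A + P.B * P.K) ^ (P.lag + 1)) *ᵥ s.x j ω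
      + (P.C₁ * (P.A + P.B * P.K) ^ P.lag) *ᵥ (P.B *ᵥ (P.K *ᵥ (s.x' j ω - s.x j ω)) + I.w j ω)
      + ∑ k ∈ Finset.range P.lag,
          (P.C₁ * (P.A + P.B * P.K) ^ (P.lag - 1 - k)) *ᵥ I.w (j + 1 + k) ω with hrest
  have hrestM : Measurable[𝓖] rest :=
    (((measurable_mulVec _).comp hj.x).add ((measurable_mulVec _).comp
      (((measurable_mulVec _).comp ((measurable_mulVec _).comp (hj.x'.sub hj.x))).add
        (measurable_inputs h j).1))).add
      (Finset.measurable_fun_sum _ fun k _ => (measurable_mulVec _).comp (measurable_inputs h _).1)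
  convert ((((measurable_mulVec P.C₁).comp herror).sub hz).sub
    (((measurable_mulVec P.C₁).comp hξ).add hζ)).add ((hrestM.add hz).const_smul a.γ) using 2
    with ω
  simp only [hrest, Function.comp_apply, Pi.add_apply, Pi.sub_apply, Pi.smul_apply, smul_add]
  abel

end Feedthrough

end Measurability

section NominalResidual

variable {mΩ : MeasurableSpace Ω} {μ : Measure Ω}

/-- The residual of the attack-free loop. -/
def nominalResidual (P : Plant p q m) (I : Inputs Ω p q m) (n : ℕ) (ω : Ω) : Fin m → ℝ :=
  P.C₁ *ᵥ nominalError P I n ω - I.z n ω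

theorem trace_Phi₁ {_ : MeasurableSpace Ω} (μ : Measure Ω) (N : ℕ) (ω : Ω) :
    (Phi₁ μ P I s N ω).trace
      = (N : ℝ)⁻¹ * ∑ n ∈ Finset.range N, residual P I s n ω ⬝ᵥ residual P I s n ω
        - (N : ℝ)⁻¹ * ∑ n ∈ Finset.range N, (secondMoment μ (nominalResidual P I n)).trace := by
  simp only [Phi₁, Matrix.trace_sub, Matrix.trace_smul, Matrix.trace_sum, smul_eq_mul,
    Matrix.trace_vecMulVec, one_div]
  rfl

theorem uniformlyBounded_nominalResidual (hobs : SchurStable (P.A + P.L₁ * P.C₁))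
    (hw : UniformlyBounded μ I.w) (hz : UniformlyBounded μ I.z) :
    UniformlyBounded μ (nominalResidual P I) := by
  have hinput : UniformlyBounded μ fun n ω => -I.w n ω - P.L₁ *ᵥ I.z n ω :=
    (hw.prodMk hz).continuous_comp (f := fun v => -v.1 - P.L₁ *ᵥ v.2) (by fun_prop)
  have herror : UniformlyBounded μ (nominalError P I) :=
    UniformlyBounded.linear_recursion hobs.summable hinput (fun _ => rfl) fun n ω => by
      rw [nominalError]
      abel
  exact (herror.prodMk hz).continuous_comp (f := fun v => P.C₁ *ᵥ v.1 - v.2) (by fun_prop)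

theorem trace_secondMoment {d : ℕ} {X : Ω → Fin d → ℝ}
    (hX : ∀ i, Integrable (fun ω => X ω i * X ω i) μ) :
    (secondMoment μ X).trace = ∫ ω, X ω ⬝ᵥ X ω ∂μ := by
  simp only [Matrix.trace, diag_apply, secondMoment, of_apply, dotProduct]
  exact (integral_finsetSum _ fun i _ => hX i).symm

theorem UniformlyBounded.exists_trace_secondMoment_le [IsProbabilityMeasure μ] {d : ℕ}
    {X : ℕ → Ω → Fin d → ℝ} (hX : UniformlyBounded μ X) :
    ∃ T, 0 ≤ T ∧ ∀ n, (secondMoment μ (X n)).trace ≤ T := by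
  have hsq (i : Fin d) : UniformlyBounded μ fun n ω => X n ω i * X n ω i :=
    hX.continuous_comp (f := fun v => v i * v i) (by fun_prop)
  choose R hR using fun i => (hsq i).exists_norm_integral_le
  refine ⟨∑ i, R i, Finset.sum_nonneg fun i _ => (norm_nonneg _).trans (hR i 0), fun n => ?_⟩
  exact Finset.sum_le_sum fun i _ => (Real.le_norm_self _).trans (hR i n)

theorem sum_residual_dotProduct_self_le {T : ℝ}
    (hT : ∀ n, (secondMoment μ (nominalResidual P I n)).trace ≤ T) {N : ℕ} {ω : Ω}
    (hΦ : ‖Phi₁ μ P I s N ω‖ ≤ 1) :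
    ∑ n ∈ Finset.range N, residual P I s n ω ⬝ᵥ residual P I s n ω ≤ (m + T) * N := by
  rcases N.eq_zero_or_pos with rfl | hN
  · simp
  have hN' : (0 : ℝ) < N := Nat.cast_pos.2 hN
  have htrace : (Phi₁ μ P I s N ω).trace ≤ m := by
    refine (le_abs_self _).trans ((abs_trace_le_l2_opNorm _).trans ?_)
    rw [Fintype.card_fin]
    exact mul_le_of_le_one_right m.cast_nonneg hΦ
  have hnominal : ∑ n ∈ Finset.range N, (secondMoment μ (nominalResidual P I n)).trace ≤ N * T := by
    simpa using Finset.sum_le_sum fun n (_ : n ∈ Finset.range N) => hT n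
  rw [trace_Phi₁, ← mul_sub, inv_mul_le_iff₀ hN'] at htrace
  linarith

end NominalResidual

section FeedbackAttack

theorem sum_sq_residual_le (J d : ℕ) (ω : Ω) (i : Fin m) :
    ∑ j ∈ Finset.range J, residual P I s (j + d) ω i ^ 2
      ≤ ∑ n ∈ Finset.range (J + d), residual P I s n ω ⬝ᵥ residual P I s n ω := by
  have hnonneg (n : ℕ) : 0 ≤ residual P I s n ω ⬝ᵥ residual P I s n ω :=
    Finset.sum_nonneg fun _ _ => mul_self_nonneg _
  rw [add_comm J, Finset.sum_range_add]
  refine le_add_of_nonneg_of_le (Finset.sum_nonneg fun n _ => hnonneg n)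
    (Finset.sum_le_sum fun j _ => ?_)
  rw [add_comm j, sq, dotProduct]
  exact Finset.single_le_sum (f := fun l => residual P I s (d + j) ω l
    * residual P I s (d + j) ω l) (fun l _ => mul_self_nonneg _) (Finset.mem_univ i)

theorem eventually_lt_abs_average_mul {r f ε : ℕ → ℝ} {K c : ℝ} (hf : ∀ j, |f j| ≤ K)
    (hpred : Tendsto (fun J => (∑ j ∈ Finset.range J, (r j - f j) * ε j)
      / energy (fun j => r j - f j) J) atTop (𝓝 0))
    (hcorr : Tendsto (fun J : ℕ => (J : ℝ)⁻¹ * ∑ j ∈ Finset.range J, f j * ε j) atTop (𝓝 c))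
    (hc : c ≠ 0) (T : ℝ) :
    ∀ᶠ J : ℕ in atTop, ∑ j ∈ Finset.range J, r j ^ 2 ≤ T * J →
      |c| / 2 < |(J : ℝ)⁻¹ * ∑ j ∈ Finset.range J, r j * ε j| := by
  have hc' : 0 < |c| := abs_pos.2 hc
  set C : ℝ := 2 + 2 * |T| + 2 * K ^ 2
  have hC : 0 < C := by positivity
  have hsmall := (tendsto_order.1 hpred.abs).2 (|c| / (4 * C)) (by rw [abs_zero]; positivity)
  have hlarge := (tendsto_order.1 hcorr.abs).1 (3 * |c| / 4) (by linarith)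
  filter_upwards [hsmall, hlarge, eventually_ge_atTop 1] with J hJs hJl hJ hpower
  have hJ' : (1 : ℝ) ≤ J := by exact_mod_cast hJ
  have hJ0 : (0 : ℝ) < J := by linarith
  have henergy : energy (fun j => r j - f j) J ≤ C * J := by
    have hsq : ∑ j ∈ Finset.range J, (r j - f j) ^ 2
        ≤ ∑ j ∈ Finset.range J, (2 * r j ^ 2 + 2 * K ^ 2) :=
      Finset.sum_le_sum fun j _ => by
        have : f j ^ 2 ≤ K ^ 2 := sq_le_sq.2 ((hf j).trans (le_abs_self K))
        linarith [sq_nonneg (r j + f j)]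
    rw [Finset.sum_add_distrib, ← Finset.mul_sum, Finset.sum_const, Finset.card_range,
      nsmul_eq_mul] at hsq
    have hT : T * J ≤ |T| * J := by gcongr; exact le_abs_self T
    simp only [energy, C]
    linarith
  have hremainder : |(J : ℝ)⁻¹ * ∑ j ∈ Finset.range J, (r j - f j) * ε j| < |c| / 4 := by
    rw [abs_div, abs_of_pos (energy_pos _ J), div_lt_iff₀ (energy_pos _ J)] at hJs
    rw [abs_mul, abs_of_pos (inv_pos.2 hJ0), inv_mul_lt_iff₀ hJ0]
    refine hJs.trans_le ((mul_le_mul_of_nonneg_left henergy (by positivity)).trans_eq ?_)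
    field_simp
  have hsplit : (J : ℝ)⁻¹ * ∑ j ∈ Finset.range J, f j * ε j
      = (J : ℝ)⁻¹ * ∑ j ∈ Finset.range J, r j * ε j
        - (J : ℝ)⁻¹ * ∑ j ∈ Finset.range J, (r j - f j) * ε j := by
    rw [← mul_sub, ← Finset.sum_sub_distrib]
    simp only [sub_mul, sub_sub_cancel]
  rw [hsplit] at hJl
  linarith [abs_sub ((J : ℝ)⁻¹ * ∑ j ∈ Finset.range J, r j * ε j)
    ((J : ℝ)⁻¹ * ∑ j ∈ Finset.range J, (r j - f j) * ε j)]

theorem div_two_lt_abs_Phi₂_apply {ω : Ω} {J : ℕ} {i : Fin m} {k : Fin q} {c : ℝ}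
    (hJ : P.lag + 1 ≤ J) (hc : 0 ≤ c)
    (h : c < |(J : ℝ)⁻¹ *
      ∑ j ∈ Finset.range J, residual P I s (j + (P.lag + 1)) ω i * I.e j ω k|) :
    c / 2 < |Phi₂ P I s (J + (P.lag + 1)) ω i k| := by
  have hJ0 : (0 : ℝ) < J := by exact_mod_cast (by omega)
  have hJ2 : ((J + (P.lag + 1) : ℕ) : ℝ) ≤ 2 * J := by exact_mod_cast (by omega)
  rw [abs_mul, abs_of_pos (inv_pos.2 hJ0), lt_inv_mul_iff₀ hJ0] at h
  rw [Phi₂_apply, abs_mul, abs_of_nonneg (by positivity), lt_inv_mul_iff₀ (by positivity)]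
  nlinarith

variable {mΩ : MeasurableSpace Ω} {μ : Measure Ω}

theorem integral_mulVec_mul {ι : Type*} {d : ℕ} {X : Ω → Fin d → ℝ} {k : Fin d}
    (hX : ∀ l, Integrable (fun ω => X ω l * X ω k) μ) (H : Matrix ι (Fin d) ℝ) (i : ι) :
    ∫ ω, (H *ᵥ X ω) i * X ω k ∂μ = (H * secondMoment μ X) i k := by
  simp only [mulVec, dotProduct, Finset.sum_mul, mul_assoc]
  rw [integral_finsetSum _ fun l _ => (hX l).const_mul _, Matrix.mul_apply]
  simp only [integral_const_mul, secondMoment, of_apply]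

theorem IsWhiteNoise.ae_tendsto_average_mulVec_mul [IsFiniteMeasure μ] {ι : Type*} {d : ℕ}
    {X : ℕ → Ω → Fin d → ℝ} (hX : IsWhiteNoise μ X) (H : Matrix ι (Fin d) ℝ) (i : ι) (k : Fin d) :
    ∀ᵐ ω ∂μ, Tendsto (fun J : ℕ => (J : ℝ)⁻¹ * ∑ j ∈ Finset.range J, (H *ᵥ X j ω) i * X j ω k)
      atTop (𝓝 ((H * secondMoment μ (X 0)) i k)) := by
  have hmul {u v : (Fin d → ℝ) → ℝ} (hu : Continuous u) (hv : Continuous v) :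
      Integrable (fun ω => u (X 0 ω) * v (X 0 ω)) μ :=
    (hX.bounded.continuous_comp (hu.mul hv)).integrable
      ((hu.mul hv).measurable.comp (hX.measurable 0)).aestronglyMeasurable
  have hcont : Continuous fun v : Fin d → ℝ => (H *ᵥ v) i := by fun_prop
  have hf : Measurable fun v : Fin d → ℝ => (H *ᵥ v) i * v k := by fun_prop
  rw [← integral_mulVec_mul fun l => hmul (continuous_apply l) (continuous_apply k)]
  exact strong_law_ae (fun j ω => (H *ᵥ X j ω) i * X j ω k) (hmul hcont (continuous_apply k))
    (fun _ _ hjl => (hX.indep.indepFun hjl).comp hf hf) fun j => (hX.identDistrib j).comp hf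

theorem IsWhiteNoise.boundedCentered {E : Type*} [NormedAddCommGroup E] [NormedSpace ℝ E]
    [MeasurableSpace E] {X : ℕ → Ω → E} (hX : IsWhiteNoise μ X) {G : ℕ → MeasurableSpace Ω}
    (hG : ∀ n, Measurable[G n] (X n)) : BoundedCentered μ G X :=
  ⟨hG, hX.bounded, hX.mean_zero⟩

theorem exists_mul_apply_ne_zero {ι κ : Type*} [Fintype κ] [DecidableEq κ] {H : Matrix ι κ ℝ}
    (hH : H ≠ 0) {Q : Matrix κ κ ℝ} (hQ : IsUnit Q) : ∃ i k, (H * Q) i k ≠ 0 := by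
  obtain ⟨U, rfl⟩ := hQ
  by_contra! h
  have hzero : H * (U : Matrix κ κ ℝ) = 0 := Matrix.ext h
  refine hH ?_
  rw [← Matrix.mul_one H, ← U.mul_inv, ← Matrix.mul_assoc, hzero, Matrix.zero_mul]

/-- The σ-algebras generated by the excitation at each time and by all other random data. -/
abbrev excitationFamily (I : Inputs Ω p q m) (a : Attack Ω p m) (s : Signals Ω p m) :
    ℕ ⊕ Unit → MeasurableSpace Ω :=
  Sum.elim (fun n => MeasurableSpace.comap (I.e n) inferInstance)
    fun _ => MeasurableSpace.comap (exogenous I a s) inferInstance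

/-- The times at which the members of `excitationFamily` are revealed: the exogenous data, future
noises included, are available at time `0`. -/
def excitationTime : ℕ ⊕ Unit → ℕ := Sum.elim (fun n => n + 1) fun _ => 0

theorem measurable_exogenous (hI : I.Admissible μ) (hpriv : PrivateExcitation μ I a s) :
    Measurable (exogenous I a s) :=
  (hpriv.measurable_x.prodMk (hpriv.measurable_x'.prodMk hpriv.measurable_ξ)).prodMk
    (measurable_pi_lambda _ fun n => (hI.process.measurable n).prodMk
      ((hI.measurement₁.measurable n).prodMk ((hI.measurement₂.measurable n).prodMk
        ((hpriv.measurable_d n).prodMk (hpriv.measurable_ζ n)))))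

theorem excitationFamily_le (hI : I.Admissible μ) (hpriv : PrivateExcitation μ I a s)
    (k : ℕ ⊕ Unit) : excitationFamily I a s k ≤ mΩ := by
  cases k with
  | inl n => exact (hI.excitation.measurable n).comap_le
  | inr _ => exact (measurable_exogenous hI hpriv).comap_le

theorem iSup_comap_le {Ω E : Type*} [MeasurableSpace E] (f : ℕ → Ω → E) :
    ⨆ n, MeasurableSpace.comap (f n) inferInstance
      ≤ MeasurableSpace.comap (fun ω n => f n ω) inferInstance :=
  iSup_le fun n => ((measurable_pi_apply n).comp
    (comap_measurable fun (ω : Ω) (n : ℕ) => f n ω)).comap_le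

variable [IsProbabilityMeasure μ]

theorem iIndep_excitationFamily (hI : I.Admissible μ) (hpriv : PrivateExcitation μ I a s) :
    iIndep (excitationFamily I a s) μ :=
  iIndep_sumElim hI.excitation.indep.iIndep iIndep.of_subsingleton <|
    indep_of_indep_of_le ((IndepFun_iff_Indep _ _ _).1 hpriv.indep) (iSup_comap_le I.e)
      (iSup_le fun _ => le_rfl)

theorem exists_isInnovation_excitation (hI : I.Admissible μ) (hpriv : PrivateExcitation μ I a s) :
    ∃ (F : Filtration ℕ mΩ) (G : ℕ → MeasurableSpace Ω), IsInnovation μ F G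
      ∧ (∀ n, Measurable[F n] (exogenous I a s)) ∧ (∀ n, Measurable[G n] (I.e n))
      ∧ ∀ n, ∀ k < n, Measurable[F n] (I.e k) :=
  ⟨past (excitationFamily I a s) (excitationFamily_le hI hpriv) excitationTime,
    innovation (excitationFamily I a s) excitationTime,
    isInnovation_past (iIndep_excitationFamily hI hpriv),
    fun n => (comap_measurable _).mono
      (le_past (m := excitationFamily I a s) (k := Sum.inr ()) n.zero_le) le_rfl,
    fun _ => (comap_measurable _).mono
      (le_innovation (m := excitationFamily I a s) (k := Sum.inl _) rfl) le_rfl,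
    fun _ _ hk => (comap_measurable _).mono
      (le_past (m := excitationFamily I a s) (k := Sum.inl _) hk) le_rfl⟩

theorem ae_tendsto_sum_residual_sub_feedthrough_mul (hI : I.Admissible μ)
    (hpriv : PrivateExcitation μ I a s) (hloop : ClosedLoop P I a s) {ρ S : ℝ} {τ : ℕ}
    (hswitch : SwitchingRule μ P I s ρ S τ) (i : Fin m) (k : Fin q) :
    ∀ᵐ ω ∂μ, Tendsto (fun J => (∑ j ∈ Finset.range J,
        (residual P I s (j + (P.lag + 1)) ω i - a.γ * (P.feedthrough *ᵥ I.e j ω) i) * I.e j ω k)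
      / energy (fun j => residual P I s (j + (P.lag + 1)) ω i
          - a.γ * (P.feedthrough *ᵥ I.e j ω) i) J) atTop (𝓝 0) := by
  obtain ⟨F, G, hG, hexo, heG, heF⟩ := exists_isInnovation_excitation hI hpriv
  have hpred (j : ℕ) : Measurable[F j] fun ω =>
      residual P I s (j + (P.lag + 1)) ω i - a.γ * (P.feedthrough *ᵥ I.e j ω) i :=
    (measurable_pi_apply i).comp
      (measurable_residual_sub_feedthrough hloop hswitch (hexo j) (heF j))
  exact hG.tendsto_martingaleTransform_div_energy hpred <|
    (hI.excitation.boundedCentered heG).linearMap_comp hG.le (LinearMap.proj k)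

theorem ae_exists_eventually_lt_norm_Phi₂ (hobs : SchurStable (P.A + P.L₁ * P.C₁))
    (hlag : ∃ k : ℕ, P.C₁ * (P.A + P.B * P.K) ^ k * P.B ≠ 0) (hI : I.Admissible μ)
    (hpriv : PrivateExcitation μ I a s) (hloop : ClosedLoop P I a s) {ρ S : ℝ} {τ : ℕ}
    (hswitch : SwitchingRule μ P I s ρ S τ) (hγ : a.γ ≠ 0) :
    ∀ᵐ ω ∂μ, ∃ c > 0, ∀ᶠ N in atTop, ‖Phi₁ μ P I s N ω‖ ≤ 1 → c < ‖Phi₂ P I s N ω‖ := by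
  obtain ⟨i, k, hcov⟩ := exists_mul_apply_ne_zero (Plant.feedthrough_ne_zero hlag)
    hI.excitation_cov.isUnit
  obtain ⟨T, hT0, hT⟩ := (uniformlyBounded_nominalResidual hobs hI.process.bounded
    hI.measurement₁.bounded).exists_trace_secondMoment_le
  obtain ⟨K, -, hK⟩ := (hI.excitation.bounded.continuous_comp
    (f := fun v => a.γ * (P.feedthrough *ᵥ v) i) (by fun_prop)).exists_ae_forall_norm_le
  filter_upwards [ae_tendsto_sum_residual_sub_feedthrough_mul hI hpriv hloop hswitch i k,
    hI.excitation.ae_tendsto_average_mulVec_mul P.feedthrough i k, hK] with ω hpred hcorr hK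
  set c := a.γ * (P.feedthrough * secondMoment μ (I.e 0)) i k
  have hc : c ≠ 0 := mul_ne_zero hγ hcov
  have hcorr' : Tendsto (fun J : ℕ => (J : ℝ)⁻¹ * ∑ j ∈ Finset.range J,
      a.γ * (P.feedthrough *ᵥ I.e j ω) i * I.e j ω k) atTop (𝓝 c) :=
    (hcorr.const_mul a.γ).congr fun J => by
      simp only [mul_assoc, ← Finset.mul_sum]
      ring
  refine ⟨|c| / 2 / 2, by positivity, ?_⟩
  have hlarge := eventually_lt_abs_average_mul hK hpred hcorr' hc (2 * (m + T))
  filter_upwards [(tendsto_sub_atTop_nat (P.lag + 1)).eventually hlarge,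
    eventually_ge_atTop (2 * (P.lag + 1))] with N hN hlagN hΦ
  obtain ⟨J, rfl⟩ := Nat.exists_eq_add_of_le' (show P.lag + 1 ≤ N by omega)
  rw [Nat.add_sub_cancel] at hN
  refine (div_two_lt_abs_Phi₂_apply (by omega) (by positivity) (hN ?_)).trans_le
    (norm_apply_le_l2_opNorm (Phi₂ P I s _ ω) i k)
  have hJ : ((J + (P.lag + 1) : ℕ) : ℝ) ≤ 2 * J := by exact_mod_cast (by omega)
  refine (sum_sq_residual_le J _ ω i).trans ((sum_residual_dotProduct_self_le hT hΦ).trans ?_)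
  rw [mul_comm 2, mul_assoc]
  gcongr

end FeedbackAttack

section DisturbanceResponse

/-- The dynamics of the pair of the estimation error and the replayed state. -/
def loopMatrix (P : Plant p q m) : Matrix (Fin p ⊕ Fin p) (Fin p ⊕ Fin p) ℝ :=
  fromBlocks (P.A + P.L₁ * P.C₁) (-(P.L₁ * P.C₁)) 0 (P.A + P.B * P.K)

/-- The contribution of the estimation error and the replayed state to the residual of an attack
with zero gain. -/
def outMatrix (P : Plant p q m) : Matrix (Fin m) (Fin p ⊕ Fin p) ℝ := fromCols P.C₁ (-P.C₁)

/-- The input that the noises `(w, z)` feed into the dynamics `loopMatrix`. -/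
def noiseInput (P : Plant p q m) :
    (Fin p → ℝ) × (Fin m → ℝ) →ₗ[ℝ] (Fin p ⊕ Fin p → ℝ) where
  toFun ν := Sum.elim (-ν.1 - P.L₁ *ᵥ ν.2) 0
  map_add' ν ν' := by ext (i | i) <;> simp [mulVec_add]; ring
  map_smul' c ν := by ext (i | i) <;> simp [mulVec_smul]; ring

/-- The input that the attack disturbances `(d, ζ)` feed into the dynamics `loopMatrix`. -/
def attackInput (P : Plant p q m) :
    (Fin p → ℝ) × (Fin m → ℝ) →ₗ[ℝ] (Fin p ⊕ Fin p → ℝ) where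
  toFun ν := Sum.elim (-(P.L₁ *ᵥ ν.2)) ν.1
  map_add' ν ν' := by ext (i | i) <;> simp [mulVec_add]; ring
  map_smul' c ν := by ext (i | i) <;> simp [mulVec_smul]

/-- The impulse response from the attack disturbances `(d, ζ)` to the residual. -/
def response (P : Plant p q m) : ℕ → (Fin p → ℝ) × (Fin m → ℝ) →ₗ[ℝ] (Fin m → ℝ)
  | 0 => -LinearMap.snd ℝ _ _
  | j + 1 => (outMatrix P * loopMatrix P ^ j).mulVecLin ∘ₗ attackInput P

/-- The part of the estimation error and the replayed state that is caused by the attack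
disturbances. -/
def attackState (P : Plant p q m) (a : Attack Ω p m) : ℕ → Ω → Fin p ⊕ Fin p → ℝ
  | 0, _ => 0
  | n + 1, ω => loopMatrix P *ᵥ attackState P a n ω + attackInput P (a.d n ω, a.ζ n ω)

/-- The part of the residual that is caused by the attack disturbances. -/
def attackOutput (P : Plant p q m) (a : Attack Ω p m) (n : ℕ) (ω : Ω) : Fin m → ℝ :=
  outMatrix P *ᵥ attackState P a n ω - a.ζ n ω

theorem loopMatrix_mulVec (P : Plant p q m) (u v : Fin p → ℝ) :
    loopMatrix P *ᵥ Sum.elim u v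
      = Sum.elim ((P.A + P.L₁ * P.C₁) *ᵥ u - P.L₁ *ᵥ (P.C₁ *ᵥ v)) ((P.A + P.B * P.K) *ᵥ v) := by
  rw [loopMatrix, fromBlocks_mulVec, Sum.elim_comp_inl, Sum.elim_comp_inr, neg_mulVec, zero_mulVec,
    zero_add, ← mulVec_mulVec, sub_eq_add_neg]

theorem outMatrix_mulVec (P : Plant p q m) (u v : Fin p → ℝ) :
    outMatrix P *ᵥ Sum.elim u v = P.C₁ *ᵥ u - P.C₁ *ᵥ v := by
  rw [outMatrix, fromCols_mulVec, Sum.elim_comp_inl, Sum.elim_comp_inr, neg_mulVec, sub_eq_add_neg]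

theorem sumElim_add (u u' v v' : Fin p → ℝ) :
    Sum.elim (u + u') (v + v') = Sum.elim u v + Sum.elim u' v' := by
  ext (i | i) <;> rfl

theorem summable_norm_loopMatrix_pow (hobs : SchurStable (P.A + P.L₁ * P.C₁))
    (hfb : SchurStable (P.A + P.B * P.K)) : Summable fun k => ‖loopMatrix P ^ k‖ :=
  hobs.summable_fromBlocks hfb _

theorem attackOutput_eq_sum (n : ℕ) (ω : Ω) : attackOutput P a n ω
    = ∑ k ∈ Finset.range (n + 1), response P (n - k) (a.d k ω, a.ζ k ω) := by
  rw [attackOutput, linear_recursion (s := fun n => attackState P a n ω) (fun _ => rfl) n,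
    attackState, mulVec_zero, zero_add, Finset.sum_range_succ, Nat.sub_self, Matrix.mulVec_sum,
    sub_eq_add_neg]
  congr 1
  refine Finset.sum_congr rfl fun k hk => ?_
  obtain ⟨j, rfl⟩ := Nat.exists_eq_add_of_lt (Finset.mem_range.1 hk)
  rw [show k + j + 1 - 1 - k = j by omega, show k + j + 1 - k = j + 1 by omega, mulVec_mulVec]
  rfl

/-- The part of the estimation error and the replayed state that is caused by all disturbances. -/
def disturbanceState (P : Plant p q m) (I : Inputs Ω p q m) (a : Attack Ω p m) (n : ℕ) (ω : Ω) :
    Fin p ⊕ Fin p → ℝ :=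
  Sum.elim (nominalError P I n ω) 0 + attackState P a n ω

theorem disturbanceState_zero (ω : Ω) : disturbanceState P I a 0 ω = 0 := by
  rw [disturbanceState, attackState, nominalError]
  ext (i | i) <;> simp

theorem disturbanceState_succ (n : ℕ) (ω : Ω) : disturbanceState P I a (n + 1) ω
    = loopMatrix P *ᵥ disturbanceState P I a n ω
      + (noiseInput P (I.w n ω, I.z n ω) + attackInput P (a.d n ω, a.ζ n ω)) := by
  have hnominal : Sum.elim (nominalError P I (n + 1) ω) (0 : Fin p → ℝ)
      = loopMatrix P *ᵥ Sum.elim (nominalError P I n ω) 0 + noiseInput P (I.w n ω, I.z n ω) := by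
    rw [loopMatrix_mulVec, noiseInput, LinearMap.coe_mk, AddHom.coe_mk, ← sumElim_add, nominalError]
    simp only [mulVec_zero, sub_zero, add_zero, add_sub, ← sub_eq_add_neg]
  rw [disturbanceState, disturbanceState, hnominal, attackState, mulVec_add]
  abel

theorem outMatrix_mulVec_disturbanceState (n : ℕ) (ω : Ω) :
    outMatrix P *ᵥ disturbanceState P I a n ω + (-I.z n ω - a.ζ n ω)
      = nominalResidual P I n ω + attackOutput P a n ω := by
  rw [disturbanceState, mulVec_add, outMatrix_mulVec, mulVec_zero, sub_zero, nominalResidual,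
    attackOutput]
  abel

theorem ClosedLoop.sumElim_estimationError_ξ (hloop : ClosedLoop P I a s) (hγ : a.γ = 0) (n : ℕ)
    (ω : Ω) : Sum.elim (estimationError s n ω) (s.ξ n ω)
      = loopMatrix P ^ n *ᵥ Sum.elim 0 (s.ξ 0 ω) + disturbanceState P I a n ω := by
  induction n with
  | zero =>
    rw [hloop.estimationError_zero, pow_zero, one_mulVec, disturbanceState_zero, add_zero]
  | succ n ih =>
    rw [disturbanceState_succ, pow_succ', ← mulVec_mulVec, ← add_assoc, ← mulVec_add, ← ih,
      loopMatrix_mulVec, noiseInput, attackInput]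
    simp only [LinearMap.coe_mk, AddHom.coe_mk, ← sumElim_add]
    rw [hloop.estimationError_succ, hloop.replay, hloop.attack, hγ]
    congr 1
    · simp only [zero_smul, sub_zero, mulVec_add]
      abel
    · abel

theorem ClosedLoop.residual_eq_of_gain_eq_zero (hloop : ClosedLoop P I a s) (hγ : a.γ = 0) (n : ℕ)
    (ω : Ω) : residual P I s n ω = outMatrix P *ᵥ (loopMatrix P ^ n *ᵥ Sum.elim 0 (s.ξ 0 ω))
      + (nominalResidual P I n ω + attackOutput P a n ω) := by
  rw [← outMatrix_mulVec_disturbanceState, ← add_assoc, ← mulVec_add,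
    ← hloop.sumElim_estimationError_ξ hγ, outMatrix_mulVec, residual_eq, hloop.attack, hγ]
  simp only [zero_smul, sub_zero]
  abel

theorem ClosedLoop.tendsto_residual_sub (hobs : SchurStable (P.A + P.L₁ * P.C₁))
    (hfb : SchurStable (P.A + P.B * P.K)) (hloop : ClosedLoop P I a s) (hγ : a.γ = 0)
    (ω : Ω) :
    Tendsto (fun n => residual P I s n ω - (nominalResidual P I n ω + attackOutput P a n ω))
      atTop (𝓝 0) := by
  have hout : Continuous fun u => outMatrix P *ᵥ u := by fun_prop
  have hfree := (hout.tendsto 0).comp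
    (tendsto_pow_mulVec (summable_norm_loopMatrix_pow hobs hfb) (Sum.elim 0 (s.ξ 0 ω)))
  rw [mulVec_zero] at hfree
  exact hfree.congr fun n => by
    rw [hloop.residual_eq_of_gain_eq_zero hγ, add_sub_cancel_right, Function.comp_apply]

theorem ClosedLoop.attackState_eq_of_attackOutput_eq_zero (hloop : ClosedLoop P I a s) {ω : Ω}
    (h : ∀ n, attackOutput P a n ω = 0) (n : ℕ) : attackState P a n ω
      = Sum.elim (0 : Fin p → ℝ) (s.ξ n ω - (P.A + P.B * P.K) ^ n *ᵥ s.ξ 0 ω) := by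
  induction n with
  | zero =>
    rw [pow_zero, one_mulVec, sub_self, attackState]
    ext (i | i) <;> rfl
  | succ n ih =>
    have hζ := h n
    rw [attackOutput, ih, outMatrix_mulVec, mulVec_zero, zero_sub, sub_eq_zero] at hζ
    rw [attackState, ih, loopMatrix_mulVec, attackInput, LinearMap.coe_mk, AddHom.coe_mk,
      ← sumElim_add, ← hζ, hloop.replay]
    congr 1
    · simp only [mulVec_neg, mulVec_zero]
      abel
    · rw [mulVec_sub, mulVec_mulVec, ← pow_succ']
      abel

theorem ClosedLoop.attack_eq_of_attackOutput_eq_zero (hloop : ClosedLoop P I a s) (hγ : a.γ = 0)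
    {ω : Ω} (h : ∀ n, attackOutput P a n ω = 0) (n : ℕ) :
    s.v n ω = P.C₁ *ᵥ ((P.A + P.B * P.K) ^ n *ᵥ s.ξ 0 ω) := by
  have hζ := h n
  rw [attackOutput, hloop.attackState_eq_of_attackOutput_eq_zero h, outMatrix_mulVec, mulVec_zero,
    zero_sub, sub_eq_zero] at hζ
  rw [hloop.attack, hγ, ← hζ, mulVec_sub]
  simp

end DisturbanceResponse

section SecondMoments

variable {mΩ : MeasurableSpace Ω} {μ : Measure Ω}

theorem integral_dotProduct_self_add_of_indep [IsFiniteMeasure μ] {ι : Type*} [Fintype ι]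
    {m₁ m₂ : MeasurableSpace Ω} (h : Indep m₁ m₂ μ) (h₁ : m₁ ≤ mΩ) (h₂ : m₂ ≤ mΩ)
    {X Y : Ω → ι → ℝ} (hX : Measurable[m₁] X) (hY : Measurable[m₂] Y) (hX2 : MemLp X 2 μ)
    (hY2 : MemLp Y 2 μ) (hX0 : ∫ ω, X ω ∂μ = 0) :
    ∫ ω, (Y ω + X ω) ⬝ᵥ (Y ω + X ω) ∂μ = ∫ ω, Y ω ⬝ᵥ Y ω ∂μ + ∫ ω, X ω ⬝ᵥ X ω ∂μ := by
  have hint {U V : Ω → ι → ℝ} (hU : MemLp U 2 μ) (hV : MemLp V 2 μ) (i : ι) :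
      Integrable (fun ω => U ω i * V ω i) μ := (hU.eval i).integrable_mul (hV.eval i)
  have hdot {U V : Ω → ι → ℝ} (hU : MemLp U 2 μ) (hV : MemLp V 2 μ) :
      Integrable (fun ω => U ω ⬝ᵥ V ω) μ := integrable_finsetSum _ fun i _ => hint hU hV i
  have hcross : ∫ ω, Y ω ⬝ᵥ X ω ∂μ = 0 := by
    simp only [dotProduct]
    rw [integral_finsetSum _ fun i _ => hint hY2 hX2 i]
    refine Finset.sum_eq_zero fun i _ => integral_mul_eq_zero_of_indep h h₁ h₂
      ((measurable_pi_apply i).comp hX) ((measurable_pi_apply i).comp hY) ?_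
    have hmean := integral_linearMap_comp (hX2.integrable one_le_two) (LinearMap.proj (R := ℝ) i)
    rwa [hX0, map_zero] at hmean
  have hexpand (ω : Ω) : (Y ω + X ω) ⬝ᵥ (Y ω + X ω)
      = Y ω ⬝ᵥ Y ω + X ω ⬝ᵥ X ω + 2 * Y ω ⬝ᵥ X ω := by
    rw [add_dotProduct, dotProduct_add, dotProduct_add, dotProduct_comm (X ω) (Y ω)]
    ring
  have hsquares : Integrable (fun ω => Y ω ⬝ᵥ Y ω + X ω ⬝ᵥ X ω) μ :=
    (hdot hY2 hY2).add (hdot hX2 hX2)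
  simp only [hexpand]
  rw [integral_add hsquares ((hdot hY2 hX2).const_mul 2),
    integral_add (hdot hY2 hY2) (hdot hX2 hX2), integral_const_mul, hcross, mul_zero, add_zero]

section WhiteNoise

variable {E : Type*} [NormedAddCommGroup E] [NormedSpace ℝ E] [FiniteDimensional ℝ E]
  [MeasurableSpace E] [BorelSpace E] {X : ℕ → Ω → E}

theorem IsWhiteNoise.variance_linearMap_comp (hX : IsWhiteNoise μ X) (f : E →ₗ[ℝ] ℝ) (n : ℕ) :
    Var[fun ω => f (X n ω); μ] = Var[fun ω => f (X 0 ω); μ] :=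
  ((hX.identDistrib n).comp f.continuous_of_finiteDimensional.measurable).variance_eq

variable [IsProbabilityMeasure μ]

theorem IsWhiteNoise.memLp_linearMap_comp (hX : IsWhiteNoise μ X) (f : E →ₗ[ℝ] ℝ) (n : ℕ) :
    MemLp (fun ω => f (X n ω)) 2 μ :=
  have hf : Continuous f := f.continuous_of_finiteDimensional
  ((hX.bounded.continuous_comp hf).memLp_top
    (hf.measurable.comp (hX.measurable n)).aestronglyMeasurable).mono_exponent le_top

theorem IsWhiteNoise.variance_le_variance_sum (hX : IsWhiteNoise μ X) (f : ℕ → E →ₗ[ℝ] ℝ)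
    {t : Finset ℕ} {k : ℕ} (hk : k ∈ t) :
    Var[fun ω => f k (X 0 ω); μ] ≤ Var[fun ω => ∑ l ∈ t, f l (X l ω); μ] := by
  have hf (l : ℕ) : Measurable (f l) := (f l).continuous_of_finiteDimensional.measurable
  have hindep : Set.Pairwise ↑t fun l l' => (fun ω => f l (X l ω)) ⟂ᵢ[μ] fun ω => f l' (X l' ω) :=
    fun l _ l' _ hll' => (hX.indep.indepFun hll').comp (hf l) (hf l')
  calc Var[fun ω => f k (X 0 ω); μ] = Var[fun ω => f k (X k ω); μ] :=
        (hX.variance_linearMap_comp (f k) k).symm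
    _ ≤ ∑ l ∈ t, Var[fun ω => f l (X l ω); μ] :=
        Finset.single_le_sum (f := fun l => Var[fun ω => f l (X l ω); μ])
          (fun l _ => variance_nonneg _ _) hk
    _ = Var[fun ω => ∑ l ∈ t, f l (X l ω); μ] := by
        rw [← IndepFun.variance_sum (fun l _ => hX.memLp_linearMap_comp (f l) l) hindep]
        simp only [Finset.sum_fn]

theorem IsWhiteNoise.ae_linearMap_eq_zero (hX : IsWhiteNoise μ X) (f : E →ₗ[ℝ] ℝ)
    (hvar : Var[fun ω => f (X 0 ω); μ] = 0) (n : ℕ) : ∀ᵐ ω ∂μ, f (X n ω) = 0 := by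
  have hmemLp := hX.memLp_linearMap_comp f n
  have hmean : ∫ ω, f (X n ω) ∂μ = 0 := by
    rw [integral_linearMap_comp (hX.bounded.integrable (hX.measurable n).aestronglyMeasurable) f,
      hX.mean_zero n, map_zero]
  rw [← hX.variance_linearMap_comp f n, variance_of_integral_eq_zero hmemLp.aemeasurable hmean,
    integral_eq_zero_iff_of_nonneg (fun ω => sq_nonneg _) hmemLp.integrable_sq] at hvar
  filter_upwards [hvar] with ω hω using pow_eq_zero_iff two_ne_zero |>.1 hω

end WhiteNoise

end SecondMoments

section Averages

theorem tendsto_dotProduct_self_sub {ι : Type*} [Fintype ι] {u v : ℕ → ι → ℝ} {R : ℝ}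
    (hv : ∀ n, ‖v n‖ ≤ R) (h : Tendsto (fun n => u n - v n) atTop (𝓝 0)) :
    Tendsto (fun n => u n ⬝ᵥ u n - v n ⬝ᵥ v n) atTop (𝓝 0) := by
  have hcoord (i : ι) : Tendsto (fun n => (u n - v n) i * (u n + v n) i) atTop (𝓝 0) := by
    have hi : Tendsto (fun n => (u n - v n) i) atTop (𝓝 0) := tendsto_pi_nhds.1 h i
    have hbdd : IsBoundedUnder (· ≤ ·) atTop (norm ∘ fun n => v n i) :=
      isBoundedUnder_of ⟨R, fun n => (norm_le_pi_norm (v n) i).trans (hv n)⟩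
    have hsum := (hi.mul hi).add ((hi.zero_mul_isBoundedUnder_le hbdd).const_mul 2)
    simp only [mul_zero, add_zero] at hsum
    refine hsum.congr fun n => ?_
    simp only [Pi.sub_apply, Pi.add_apply]
    ring
  have hsum := tendsto_finsetSum Finset.univ fun i _ => hcoord i
  rw [Finset.sum_const_zero] at hsum
  refine hsum.congr fun n => ?_
  change (u n - v n) ⬝ᵥ (u n + v n) = _
  rw [sub_dotProduct, dotProduct_add, dotProduct_add, dotProduct_comm (v n) (u n)]
  ring

theorem eventually_lt_average {f : ℕ → ℝ} {c c' : ℝ} (hf : ∀ᶠ n in atTop, c ≤ f n) (hc : c' < c) :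
    ∀ᶠ N : ℕ in atTop, c' < (N : ℝ)⁻¹ * ∑ n ∈ Finset.range N, f n := by
  have hmin : Tendsto (fun n => min (f n) c) atTop (𝓝 c) :=
    tendsto_const_nhds.congr' (hf.mono fun n hn => (min_eq_right hn).symm)
  refine (hmin.cesaro.eventually_const_lt hc).mono fun N hN => hN.trans_le ?_
  gcongr
  exact min_le_left _ _

end Averages

section AdditiveAttack

variable {mΩ : MeasurableSpace Ω} {μ : Measure Ω}

/-- The σ-algebras generated by the process noise, the measurement noise of the vulnerable sensor
and the attack disturbances at each time. -/
abbrev disturbanceFamily (I : Inputs Ω p q m) (a : Attack Ω p m) :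
    (ℕ ⊕ ℕ) ⊕ ℕ → MeasurableSpace Ω :=
  Sum.elim (Sum.elim (fun n => MeasurableSpace.comap (I.w n) inferInstance)
    (fun n => MeasurableSpace.comap (I.z n) inferInstance))
    (fun n => MeasurableSpace.comap (fun ω => (a.d n ω, a.ζ n ω)) inferInstance)

/-- The times at which the members of `disturbanceFamily` are revealed. -/
def disturbanceTime : (ℕ ⊕ ℕ) ⊕ ℕ → ℕ :=
  Sum.elim (Sum.elim (· + 1) (· + 1)) (· + 1)

/-- The σ-algebra generated by all noises of the plant. -/
abbrev noiseσ (I : Inputs Ω p q m) : MeasurableSpace Ω :=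
  MeasurableSpace.comap (fun ω n => (I.w n ω, I.z n ω, I.η n ω)) inferInstance

/-- The σ-algebra generated by all attack disturbances. -/
abbrev attackσ (a : Attack Ω p m) : MeasurableSpace Ω :=
  MeasurableSpace.comap (fun ω n => (a.d n ω, a.ζ n ω)) inferInstance

theorem measurable_noise (I : Inputs Ω p q m) (n : ℕ) :
    Measurable[noiseσ I] fun ω => (I.w n ω, I.z n ω, I.η n ω) :=
  (measurable_pi_apply n).comp
    (comap_measurable fun (ω : Ω) (n : ℕ) => (I.w n ω, I.z n ω, I.η n ω))

theorem measurable_attack (a : Attack Ω p m) (n : ℕ) :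
    Measurable[attackσ a] fun ω => (a.d n ω, a.ζ n ω) :=
  (measurable_pi_apply n).comp (comap_measurable fun (ω : Ω) (n : ℕ) => (a.d n ω, a.ζ n ω))

theorem noiseσ_le (hI : I.Admissible μ) : noiseσ I ≤ mΩ :=
  (measurable_pi_lambda _ fun n => (hI.process.measurable n).prodMk
    ((hI.measurement₁.measurable n).prodMk (hI.measurement₂.measurable n))).comap_le

theorem attackσ_le (h : a.IsWhite μ I) : attackσ a ≤ mΩ :=
  (measurable_pi_lambda _ h.white.measurable).comap_le

theorem measurable_nominalResidual (P : Plant p q m) (I : Inputs Ω p q m) (n : ℕ) :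
    Measurable[noiseσ I] (nominalResidual P I n) := by
  have herror (n : ℕ) : Measurable[noiseσ I] (nominalError P I n) := by
    induction n with
    | zero => exact measurable_const
    | succ n ih =>
      exact (((measurable_mulVec _).comp ih).sub (measurable_noise I n).fst).sub
        ((measurable_mulVec _).comp (measurable_noise I n).snd.fst)
  exact ((measurable_mulVec _).comp (herror n)).sub (measurable_noise I n).snd.fst

theorem disturbanceFamily_le (hI : I.Admissible μ) (h : a.IsWhite μ I) (k : (ℕ ⊕ ℕ) ⊕ ℕ) :
    disturbanceFamily I a k ≤ mΩ := by
  rcases k with (n | n) | n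
  · exact (hI.process.measurable n).comap_le
  · exact (hI.measurement₁.measurable n).comap_le
  · exact (h.white.measurable n).comap_le

theorem iIndep_disturbanceFamily (hI : I.Admissible μ) (h : a.IsWhite μ I) :
    iIndep (disturbanceFamily I a) μ := by
  have hwz : Indep (⨆ n, MeasurableSpace.comap (I.w n) inferInstance)
      (⨆ n, MeasurableSpace.comap (I.z n) inferInstance) μ :=
    indep_of_indep_of_le ((IndepFun_iff_Indep _ _ _).1 hI.indep) (iSup_comap_le I.w) <|
      iSup_le fun n => ((measurable_pi_apply n).comp
        (comap_measurable fun (ω : Ω) (n : ℕ) => (I.z n ω, I.η n ω))).fst.comap_le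
  refine iIndep_sumElim (iIndep_sumElim hI.process.indep.iIndep hI.measurement₁.indep.iIndep hwz)
    h.white.indep.iIndep ?_
  refine indep_of_indep_of_le ((IndepFun_iff_Indep _ _ _).1 h.indep).symm (iSup_le fun k => ?_)
    (iSup_comap_le fun n ω => (a.d n ω, a.ζ n ω))
  cases k with
  | inl n => exact (measurable_noise I n).fst.comap_le
  | inr n => exact (measurable_noise I n).snd.fst.comap_le

theorem exists_isInnovation_disturbance (hI : I.Admissible μ) (h : a.IsWhite μ I) :
    ∃ (F : Filtration ℕ mΩ) (G : ℕ → MeasurableSpace Ω), IsInnovation μ F G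
      ∧ (∀ n, Measurable[G n] (I.w n)) ∧ (∀ n, Measurable[G n] (I.z n))
      ∧ ∀ n, Measurable[G n] fun ω => (a.d n ω, a.ζ n ω) :=
  ⟨past (disturbanceFamily I a) (disturbanceFamily_le hI h) disturbanceTime,
    innovation (disturbanceFamily I a) disturbanceTime,
    isInnovation_past (iIndep_disturbanceFamily hI h),
    fun n => (comap_measurable _).mono
      (le_innovation (m := disturbanceFamily I a) (k := Sum.inl (Sum.inl n)) rfl) le_rfl,
    fun n => (comap_measurable _).mono
      (le_innovation (m := disturbanceFamily I a) (k := Sum.inl (Sum.inr n)) rfl) le_rfl,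
    fun n => (comap_measurable _).mono
      (le_innovation (m := disturbanceFamily I a) (k := Sum.inr n) rfl) le_rfl⟩

variable [IsProbabilityMeasure μ]

theorem Attack.IsWhite.boundedCentered_attackOutput (hobs : SchurStable (P.A + P.L₁ * P.C₁))
    (hfb : SchurStable (P.A + P.B * P.K)) (h : a.IsWhite μ I) :
    BoundedCentered μ (fun _ => attackσ a) (attackOutput P a) := by
  have hwhite := h.white.boundedCentered (measurable_attack a)
  have hle : ∀ _ : ℕ, attackσ a ≤ mΩ := fun _ => attackσ_le h
  refine ⟨fun n => ?_, ?_, fun n => ?_⟩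
  · rw [funext (attackOutput_eq_sum n)]
    exact Finset.measurable_fun_sum _ fun k _ =>
      (hwhite.linearMap_comp hle (response P (n - k))).measurable k
  · have hstate : UniformlyBounded μ (attackState P a) :=
      (hwhite.linearMap_comp hle (attackInput P)).bounded.linear_recursion
        (summable_norm_loopMatrix_pow hobs hfb) (fun _ => rfl) fun _ _ => rfl
    exact (hstate.prodMk hwhite.bounded).continuous_comp
      (f := fun v => outMatrix P *ᵥ v.1 - v.2.2) (by fun_prop)
  · simp only [attackOutput_eq_sum]
    rw [integral_finsetSum _ fun k _ =>
      (hwhite.linearMap_comp hle (response P (n - k))).integrable hle k]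
    exact Finset.sum_eq_zero fun k _ => (hwhite.linearMap_comp hle (response P (n - k))).mean_zero k

theorem Attack.IsWhite.memLp_attackOutput (hobs : SchurStable (P.A + P.L₁ * P.C₁))
    (hfb : SchurStable (P.A + P.B * P.K)) (h : a.IsWhite μ I) (n : ℕ) :
    MemLp (attackOutput P a n) 2 μ :=
  have hout := h.boundedCentered_attackOutput hobs hfb
  (hout.bounded.memLp_top ((hout.measurable n).mono (attackσ_le h) le_rfl).aestronglyMeasurable)
    |>.mono_exponent le_top

theorem memLp_nominalResidual (hobs : SchurStable (P.A + P.L₁ * P.C₁)) (hI : I.Admissible μ)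
    (n : ℕ) : MemLp (nominalResidual P I n) 2 μ :=
  ((uniformlyBounded_nominalResidual hobs hI.process.bounded
    hI.measurement₁.bounded).memLp_top ((measurable_nominalResidual P I n).mono
      (noiseσ_le hI) le_rfl).aestronglyMeasurable).mono_exponent le_top

theorem integral_dotProduct_self_nominalResidual_add (hobs : SchurStable (P.A + P.L₁ * P.C₁))
    (hfb : SchurStable (P.A + P.B * P.K)) (hI : I.Admissible μ)
    (h : a.IsWhite μ I) (n : ℕ) :
    ∫ ω, (nominalResidual P I n ω + attackOutput P a n ω)
        ⬝ᵥ (nominalResidual P I n ω + attackOutput P a n ω) ∂μ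
      = (secondMoment μ (nominalResidual P I n)).trace
        + ∫ ω, attackOutput P a n ω ⬝ᵥ attackOutput P a n ω ∂μ := by
  have hout := h.boundedCentered_attackOutput hobs hfb
  have hnominal := memLp_nominalResidual hobs hI n
  rw [trace_secondMoment fun i => (hnominal.eval i).integrable_mul (hnominal.eval i)]
  exact integral_dotProduct_self_add_of_indep ((IndepFun_iff_Indep _ _ _).1 h.indep)
    (attackσ_le h) (noiseσ_le hI) (hout.measurable n) (measurable_nominalResidual P I n)
    (h.memLp_attackOutput hobs hfb n) hnominal (hout.mean_zero n)

theorem satisfiesLLN_nominalResidual_add_attackOutput (hobs : SchurStable (P.A + P.L₁ * P.C₁))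
    (hfb : SchurStable (P.A + P.B * P.K)) (hI : I.Admissible μ)
    (h : a.IsWhite μ I) : SatisfiesLLN μ fun n ω =>
      (nominalResidual P I n ω + attackOutput P a n ω)
        ⬝ᵥ (nominalResidual P I n ω + attackOutput P a n ω) := by
  obtain ⟨F, G, hG, hw, hz, ha⟩ := exists_isInnovation_disturbance hI h
  have hz' := hI.measurement₁.boundedCentered hz
  have hall := ((hI.process.boundedCentered hw).prodMk hz' hG.le).prodMk
    (h.white.boundedCentered ha) hG.le
  have hstate := hall.linearMap_comp hG.le ((noiseInput P).coprod (attackInput P))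
  have hdirect := hall.linearMap_comp hG.le
    ((-LinearMap.snd ℝ (Fin p → ℝ) (Fin m → ℝ)).coprod (-LinearMap.snd ℝ (Fin p → ℝ) (Fin m → ℝ)))
  have hlln := hG.satisfiesLLN_dotProduct_output_self (summable_norm_loopMatrix_pow hobs hfb)
    (outMatrix P) hstate hdirect disturbanceState_zero disturbanceState_succ
  simpa only [LinearMap.coprod_apply, LinearMap.neg_apply, LinearMap.snd_apply, ← sub_eq_add_neg,
    outMatrix_mulVec_disturbanceState] using hlln

theorem Attack.IsWhite.variance_response_le (hobs : SchurStable (P.A + P.L₁ * P.C₁))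
    (hfb : SchurStable (P.A + P.B * P.K)) (h : a.IsWhite μ I) {j n : ℕ}
    (hjn : j ≤ n) (i : Fin m) : Var[fun ω => response P j (a.d 0 ω, a.ζ 0 ω) i; μ]
      ≤ ∫ ω, attackOutput P a n ω ⬝ᵥ attackOutput P a n ω ∂μ := by
  have hcoord := (h.boundedCentered_attackOutput hobs hfb).linearMap_comp (fun _ => attackσ_le h)
    (LinearMap.proj (R := ℝ) i)
  have hsum := h.white.variance_le_variance_sum
    (fun k => LinearMap.proj i ∘ₗ response P (n - k)) (t := Finset.range (n + 1)) (k := n - j)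
    (Finset.mem_range.2 (by omega))
  simp only [Nat.sub_sub_self hjn, LinearMap.comp_apply, LinearMap.proj_apply,
    ← Finset.sum_apply, ← attackOutput_eq_sum] at hsum
  have hmemLp := h.memLp_attackOutput hobs hfb n
  have hsq (l : Fin m) : Integrable (fun ω => attackOutput P a n ω l * attackOutput P a n ω l) μ :=
    (hmemLp.eval l).integrable_mul (hmemLp.eval l)
  calc _ ≤ Var[fun ω => attackOutput P a n ω i; μ] := hsum
    _ = ∫ ω, attackOutput P a n ω i * attackOutput P a n ω i ∂μ := by
        rw [variance_of_integral_eq_zero (hmemLp.eval i).aemeasurable (hcoord.mean_zero n)]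
        simp only [sq]
    _ ≤ ∫ ω, attackOutput P a n ω ⬝ᵥ attackOutput P a n ω ∂μ := by
        refine integral_mono (hsq i) (integrable_finsetSum _ fun l _ => hsq l) fun ω => ?_
        exact Finset.single_le_sum (f := fun l => attackOutput P a n ω l * attackOutput P a n ω l)
          (fun l _ => mul_self_nonneg _) (Finset.mem_univ i)

theorem Attack.IsWhite.ae_attackOutput_eq_zero (h : a.IsWhite μ I)
    (hvar : ∀ j i, Var[fun ω => response P j (a.d 0 ω, a.ζ 0 ω) i; μ] = 0) :
    ∀ᵐ ω ∂μ, ∀ n, attackOutput P a n ω = 0 := by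
  have hzero : ∀ᵐ ω ∂μ, ∀ j k i, response P j (a.d k ω, a.ζ k ω) i = 0 := by
    refine ae_all_iff.2 fun j => ae_all_iff.2 fun k => ae_all_iff.2 fun i => ?_
    have hcoord := h.white.ae_linearMap_eq_zero (LinearMap.proj i ∘ₗ response P j)
    simp only [LinearMap.comp_apply, LinearMap.proj_apply] at hcoord
    exact hcoord (hvar j i) k
  filter_upwards [hzero] with ω hω n
  rw [attackOutput_eq_sum]
  exact Finset.sum_eq_zero fun k _ => funext (hω (n - k) k)

theorem exists_variance_response_pos (hfb : SchurStable (P.A + P.B * P.K))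
    (hloop : ClosedLoop P I a s) (hγ : a.γ = 0) (h : a.IsWhite μ I)
    (hnontrivial : ¬ ∀ᵐ ω ∂μ, ∀ n, s.v n ω = 0)
    (halt : (∀ᵐ ω ∂μ, s.ξ 0 ω = 0) ∨ ¬ ZeroAveragePower μ s.v) :
    ∃ j i, 0 < Var[fun ω => response P j (a.d 0 ω, a.ζ 0 ω) i; μ] := by
  by_contra! hvar
  have hv : ∀ᵐ ω ∂μ, ∀ n, s.v n ω = P.C₁ *ᵥ ((P.A + P.B * P.K) ^ n *ᵥ s.ξ 0 ω) :=
    (h.ae_attackOutput_eq_zero fun j i => (hvar j i).antisymm (variance_nonneg _ _)).mono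
      fun ω hω => hloop.attack_eq_of_attackOutput_eq_zero hγ hω
  rcases halt with hξ | hpower
  · refine hnontrivial ?_
    filter_upwards [hv, hξ] with ω hvω hξω n
    rw [hvω, hξω, mulVec_zero, mulVec_zero]
  · refine hpower ?_
    filter_upwards [hv] with ω hvω
    have hquad : Continuous fun u : Fin p → ℝ => (P.C₁ *ᵥ u) ⬝ᵥ (P.C₁ *ᵥ u) := by fun_prop
    have hlim := ((hquad.tendsto 0).comp (tendsto_pow_mulVec hfb.summable (s.ξ 0 ω))).cesaro
    rw [mulVec_zero, zero_dotProduct] at hlim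
    simpa only [one_div, hvω, Function.comp_apply] using hlim

theorem ae_tendsto_trace_Phi₁_sub (hobs : SchurStable (P.A + P.L₁ * P.C₁))
    (hfb : SchurStable (P.A + P.B * P.K)) (hI : I.Admissible μ)
    (hloop : ClosedLoop P I a s) (hγ : a.γ = 0) (h : a.IsWhite μ I) :
    ∀ᵐ ω ∂μ, Tendsto (fun N => (Phi₁ μ P I s N ω).trace - (N : ℝ)⁻¹ * ∑ n ∈ Finset.range N,
      ∫ ω', attackOutput P a n ω' ⬝ᵥ attackOutput P a n ω' ∂μ) atTop (𝓝 0) := by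
  have hbdd : UniformlyBounded μ fun n ω => nominalResidual P I n ω + attackOutput P a n ω :=
    ((uniformlyBounded_nominalResidual hobs hI.process.bounded hI.measurement₁.bounded).prodMk
      (h.boundedCentered_attackOutput hobs hfb).bounded).continuous_comp
      (f := fun v => v.1 + v.2) (by fun_prop)
  obtain ⟨R, -, hR⟩ := hbdd.exists_ae_forall_norm_le
  filter_upwards [hR, (satisfiesLLN_nominalResidual_add_attackOutput hobs hfb hI h).tendsto]
    with ω hRω hω
  have hlim := (tendsto_dotProduct_self_sub hRω
    (hloop.tendsto_residual_sub hobs hfb hγ ω)).cesaro.add hω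
  rw [zero_add] at hlim
  refine hlim.congr fun N => ?_
  simp only [trace_Phi₁, integral_dotProduct_self_nominalResidual_add hobs hfb hI h,
    Finset.sum_sub_distrib, Finset.sum_add_distrib]
  ring

theorem ae_exists_eventually_lt_norm_Phi₁ (hobs : SchurStable (P.A + P.L₁ * P.C₁))
    (hfb : SchurStable (P.A + P.B * P.K)) (hI : I.Admissible μ)
    (hloop : ClosedLoop P I a s) (hγ : a.γ = 0) (h : a.IsWhite μ I)
    (hnontrivial : ¬ ∀ᵐ ω ∂μ, ∀ n, s.v n ω = 0)
    (halt : (∀ᵐ ω ∂μ, s.ξ 0 ω = 0) ∨ ¬ ZeroAveragePower μ s.v) :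
    ∀ᵐ ω ∂μ, ∃ c > 0, ∀ᶠ N in atTop, c < ‖Phi₁ μ P I s N ω‖ := by
  obtain ⟨j, i, hpos⟩ := exists_variance_response_pos hfb hloop hγ h hnontrivial halt
  set c := Var[fun ω => response P j (a.d 0 ω, a.ζ 0 ω) i; μ]
  have hm : (0 : ℝ) < m := Nat.cast_pos.2 i.pos
  have hpower := eventually_lt_average ((eventually_ge_atTop j).mono fun n hjn =>
    h.variance_response_le hobs hfb hjn i) (half_lt_self hpos)
  filter_upwards [ae_tendsto_trace_Phi₁_sub hobs hfb hI hloop hγ h] with ω hω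
  refine ⟨c / 4 / m, by positivity, ?_⟩
  filter_upwards [hω.eventually_const_lt (show -(c / 4) < 0 by linarith), hpower] with N hN hN'
  have htrace := (le_abs_self _).trans (abs_trace_le_l2_opNorm (Phi₁ μ P I s N ω))
  rw [Fintype.card_fin] at htrace
  rw [div_lt_iff₀' hm]
  linarith

end AdditiveAttack

section Detection

variable {mΩ : MeasurableSpace Ω} {μ : Measure Ω}

theorem measure_limsup_compl_detection_eq_zero {ρ S : ℝ}
    (h : ∀ᵐ ω ∂μ, ∃ c > 0, ∀ᶠ N in atTop, c < max ‖Phi₁ μ P I s N ω‖ ‖Phi₂ P I s N ω‖) :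
    μ (limsup (fun N : ℕ => (detection μ P I s ρ S N)ᶜ) atTop) = 0 := by
  have hdetect : ∀ᵐ ω ∂μ, ∀ᶠ N in atTop, ω ∈ detection μ P I s ρ S N := by
    filter_upwards [h] with ω ⟨c, hc, hN⟩
    filter_upwards [hN, (tendsto_threshold ρ S).eventually_lt_const hc] with N hcN htN
    exact lt_max_iff.1 (htN.trans hcN)
  refine measure_mono_null (fun ω hω => ?_) (ae_iff.1 hdetect)
  rw [mem_limsup_iff_frequently_mem] at hω
  exact fun hevent => hω (hevent.mono fun N hN hN' => hN' hN)

end Detection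

end Watermark

theorem mainTheorem3_general {Ω : Type*} [MeasurableSpace Ω] (μ : Measure Ω)
    [IsProbabilityMeasure μ] {p q m : ℕ} (P : Watermark.Plant p q m)
    (hobs : Watermark.SchurStable (P.A + P.L₁ * P.C₁))
    (hfb : Watermark.SchurStable (P.A + P.B * P.K))
    (hlag : ∃ k : ℕ, P.C₁ * (P.A + P.B * P.K) ^ k * P.B ≠ 0)
    (I : Watermark.Inputs Ω p q m) (hI : I.Admissible μ)
    (a : Watermark.Attack Ω p m) (s : Watermark.Signals Ω p m)
    (hpriv : Watermark.PrivateExcitation μ I a s)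
    (hloop : Watermark.ClosedLoop P I a s)
    (ρ S : ℝ) (τ : ℕ) (hswitch : Watermark.SwitchingRule μ P I s ρ S τ)
    (hnontrivial : ¬ ∀ᵐ ω ∂μ, ∀ n, s.v n ω = 0)
    (hzero : a.γ = 0 → a.IsWhite μ I ∧
      ((∀ᵐ ω ∂μ, s.ξ 0 ω = 0) ∨ ¬ Watermark.ZeroAveragePower μ s.v)) :
    ∀ᵐ ω ∂μ, ∃ c > 0, ∀ᶠ N in atTop,
      c < max ‖Watermark.Phi₁ μ P I s N ω‖ ‖Watermark.Phi₂ P I s N ω‖ := by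
  by_cases hγ : a.γ = 0
  · obtain ⟨hwhite, halt⟩ := hzero hγ
    filter_upwards [Watermark.ae_exists_eventually_lt_norm_Phi₁ hobs hfb hI hloop hγ hwhite
      hnontrivial halt] with ω ⟨c, hc, hN⟩
    exact ⟨c, hc, hN.mono fun N hcN => lt_max_of_lt_left hcN⟩
  · filter_upwards [Watermark.ae_exists_eventually_lt_norm_Phi₂ hobs hlag hI hpriv hloop hswitch hγ]
      with ω ⟨c, hc, hN⟩
    refine ⟨min 1 c, lt_min one_pos hc, hN.mono fun N hcN => ?_⟩
    rcases le_or_gt ‖Watermark.Phi₁ μ P I s N ω‖ 1 with hle | hgt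
    · exact lt_max_of_lt_right ((min_le_right _ _).trans_lt (hcN hle))
    · exact lt_max_of_lt_left ((min_le_left _ _).trans_lt hgt)

theorem mainTheorem3 {Ω : Type*} [MeasurableSpace Ω] (μ : Measure Ω) [IsProbabilityMeasure μ]
    {p q m : ℕ} (P : Watermark.Plant p q m) (hP : P.Stable)
    (hlag : ∃ k : ℕ, P.C₁ * (P.A + P.B * P.K) ^ k * P.B ≠ 0)
    (I : Watermark.Inputs Ω p q m) (hI : I.Admissible μ)
    (a : Watermark.Attack Ω p m) (s : Watermark.Signals Ω p m)
    (hpriv : Watermark.PrivateExcitation μ I a s)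
    (hloop : Watermark.ClosedLoop P I a s)
    (ρ S : ℝ) (hρ : 0 < ρ) (hS : 0 < S) (τ : ℕ) (hτ : 1 ≤ τ)
    (hswitch : Watermark.SwitchingRule μ P I s ρ S τ)
    (hnontrivial : ¬ ∀ᵐ ω ∂μ, ∀ n, s.v n ω = 0)
    (hzero : a.γ = 0 → a.IsWhite μ I ∧
      ((∀ᵐ ω ∂μ, s.ξ 0 ω = 0) ∨ ¬ Watermark.ZeroAveragePower μ s.v)) :
    μ (limsup (fun N : ℕ => (Watermark.detection μ P I s ρ S N)ᶜ) atTop) = 0 := by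
  exact Watermark.measure_limsup_compl_detection_eq_zero <|
    mainTheorem3_general μ P hP.observer₁ hP.feedback hlag I hI a s hpriv hloop ρ S τ hswitch
      hnontrivial hzero
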